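/- Let $\mathcal{T}$ be an infinite, locally finite tree without leaves, and let $G$ be a group acting on $\mathcal{T}$ by graph automorphisms, cocompactly and without inversions of edges; put $\Gamma=G\backslash\mathcal{T}$. A permutation $\varphi$ of $V(\mathcal{T})$ has a set $F\subset V(\mathcal T)$ as a support if for every infinite connected component $P$ of $\mathcal{T}\setminus F$ there is $g\in G$ with $\varphi|_P=g|_P$; it is rigid if it has a finite support. For a finite set $\mathcal{B}\subset V(\mathcal{T})$ let $\mathrm{RP}_G(\mathcal{T},\mathcal{B})$ be the group of rigid permutations of $V(\mathcal T)$ fixing $\mathcal{B}$ pointwise. Let $\mathfrak{G}$ be a set of half-edges of $\Gamma$ (gates). A finite (nonempty) subtree $T\subset\mathcal{T}$ is called admissible if for every leaf (vertex of degree one) $v$ of $T$ the half-edge of $T$ at $v$ projects to an element of $\mathfrak{G}$, and every interior vertex (vertex that is not a leaf) of $T$ has the same degree in $T$ as in $\mathcal{T}$. Assume that every finite subtree of $\mathcal{T}$ is contained in an admissible one, and fix an admissible tree $T_0$ with $\mathcal{B}\subset\mathrm{int}(T_0)$, where $\mathrm{int}(T)$ denotes the set of interior vertices of $T$. Consider pairs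 $(T,f)$ with $T$ an admissible tree containing $T_0$ and $f\in\mathrm{RP}_G(\mathcal{T},\mathcal{B})$. Write $(T,f)\sim(S,g)$ if $g^{-1}\circ f$ restricts to a bijection $V(T)\to V(S)$ and has $\mathrm{int}(T)$ as a support; this is an equivalence relation. Let $\mathcal{P}$ be the set of equivalence classes $[T,f]$, partially ordered by: $x\le y$ if $x=[T,f]$ and $y=[T',f]$ for some $f$ and some $T\subseteq T'$. A leaf expansion of an admissible tree $T$ at a leaf $v$ of $T$ is a minimal admissible tree $T'\supsetneq T$ in which $v$ is an interior vertex, and an elementary expansion of $T$ is a tree obtained from $T$ by a finite (possibly empty) sequence of leaf expansions at leaves of $T$. Write $x\preccurlyeq y$ if $x=[T,f]$ and $y=[T',f]$ for some $f$ and some elementary expansion $T'$ of $T$. The Stein complex $\mathfrak{X}$ is the simplicial complex with vertex set $\mathcal{P}$ whose simplices are the finite chains $v_0<v_1<\dots<v_n$ in $\mathcal{P}$ with $v_0\preccurlyeq v_n$. Then (the geometric realisation, with the weak topology, of) $\mathfrak{X}$ is contractible. -/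

import Mathlib

/-! ## Geometric realisation of an abstract simplicial complex -/

/-- The points of the geometric realisation of `K`, in barycentric coordinates: finitely supported
families of nonnegative reals with sum `1` whose support is a simplex of `K`. -/
def SimplicialRealization {ι : Type*} (K : AbstractSimplicialComplex ι) : Type _ :=
  {x : ι →₀ ℝ // (∀ v, 0 ≤ x v) ∧ x.sum (fun _ t => t) = 1 ∧ x.support ∈ K.faces}

/-- The closed simplex of the realisation spanned by the face `s`. -/
def ClosedSimplex {ι : Type*} (K : AbstractSimplicialComplex ι) (s : Finset ι) : Type _ :=
  {x : SimplicialRealization K // x.1.support ⊆ s}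

/-- The usual Euclidean topology of a closed simplex (that of its barycentric coordinates). -/
instance {ι : Type*} (K : AbstractSimplicialComplex ι) (s : Finset ι) :
    TopologicalSpace (ClosedSimplex K s) :=
  TopologicalSpace.induced (fun x (v : ι) => x.1.1 v) inferInstance

/-- The weak topology: a set is open iff its trace on every closed simplex is open. -/
instance {ι : Type*} (K : AbstractSimplicialComplex ι) :
    TopologicalSpace (SimplicialRealization K) :=
  ⨆ s : {s : Finset ι // s ∈ K.faces},
    TopologicalSpace.coinduced (fun x : ClosedSimplex K s.1 => x.1) inferInstance

namespace RigidPerm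

/-! ## Rigid permutations -/

section Rigid

variable (G : Type*) {V : Type*} [Group G] [MulAction G V] (𝒯 : SimpleGraph V)

/-- `F` is a (rigid) support of the permutation `φ`: on every infinite connected component of the
complement of `F`, `φ` agrees with some element of `G`. -/
def IsRigidSupport (φ : Equiv.Perm V) (F : Set V) : Prop :=
  ∀ C : 𝒯.ComponentCompl F, C.supp.Infinite → ∃ g : G, ∀ v ∈ C.supp, φ v = g • v

/-- The permutations of the vertices that are rigid, that is, have a finite support, and fix `B`
pointwise. -/
def rigidPermutations (B : Set V) : Set (Equiv.Perm V) :=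
  {φ | (∃ F : Set V, F.Finite ∧ IsRigidSupport G 𝒯 φ F) ∧ ∀ b ∈ B, φ b = b}

/-! ## Gates and admissible subtrees -/

/-- The half-edges of the quotient graph `G \ 𝒯`: the `G`-orbits of half-edges of `𝒯`. The dart
`(v, w)` stands for the half of the edge `{v, w}` that is incident to `v`. -/
abbrev QuotientHalfEdge : Type _ :=
  Quotient ((MulAction.orbitRel G (V × V)).comap (SimpleGraph.Dart.toProd (G := 𝒯)))

variable {G 𝒯}

/-- The label, in the quotient graph, of the half at `v` of the edge `{v, w}`. -/
def halfEdgeLabel {v w : V} (h : 𝒯.Adj v w) : QuotientHalfEdge G 𝒯 :=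
  Quotient.mk _ (SimpleGraph.Dart.mk (v, w) h)

/-- `v` is a leaf of `H`: a vertex of degree one. -/
def IsLeaf (H : 𝒯.Subgraph) (v : V) : Prop := ∃! w, H.Adj v w

/-- The interior vertices of `H`, i.e. its vertices that are not leaves. -/
def interiorVerts (H : 𝒯.Subgraph) : Set V := {v | v ∈ H.verts ∧ ¬ IsLeaf H v}

/-- A finite subtree of (the tree) `𝒯`: a finite connected (in particular nonempty) subgraph. -/
def IsFiniteSubtree (H : 𝒯.Subgraph) : Prop := H.verts.Finite ∧ H.Connected

/-- `H` is an admissible tree: a finite subtree such that the terminal half-edge at each leaf is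
labelled by a gate, and in which each interior vertex has the same degree as in `𝒯`. -/
def IsAdmissible (gates : Set (QuotientHalfEdge G 𝒯)) (H : 𝒯.Subgraph) : Prop :=
  IsFiniteSubtree H ∧
    (∀ v w, IsLeaf H v → ∀ h : H.Adj v w, halfEdgeLabel h.adj_sub ∈ gates) ∧
    ∀ v ∈ interiorVerts H, H.neighborSet v = 𝒯.neighborSet v

/-- A system of gates is admissible if every finite subtree lies in an admissible one. -/
def IsAdmissibleGateSystem (gates : Set (QuotientHalfEdge G 𝒯)) : Prop :=
  ∀ H : 𝒯.Subgraph, IsFiniteSubtree H → ∃ H' : 𝒯.Subgraph, IsAdmissible gates H' ∧ H ≤ H'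

/-- `T'` is a leaf expansion of the admissible tree `T` at the leaf `v`: it is minimal among the
admissible trees that properly contain `T` and have `v` as an interior vertex. -/
def IsLeafExpansion (gates : Set (QuotientHalfEdge G 𝒯)) (T : 𝒯.Subgraph) (v : V)
    (T' : 𝒯.Subgraph) : Prop :=
  IsLeaf T v ∧ Minimal (fun S => IsAdmissible gates S ∧ T < S ∧ v ∈ interiorVerts S) T'

/-- `T'` is an elementary expansion of `T`: it is obtained from `T` by a finite (possibly empty)
sequence of leaf expansions, each of them at a leaf of `T`. -/
def IsElementaryExpansion (gates : Set (QuotientHalfEdge G 𝒯)) (T T' : 𝒯.Subgraph) : Prop :=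
  Relation.ReflTransGen (fun S S' => ∃ v, IsLeaf T v ∧ IsLeafExpansion gates S v S') T T'

end Rigid

/-! ## The poset of classes `[T, f]` and the Stein complex -/

section Stein

variable {G V : Type*} [Group G] [MulAction G V] {𝒯 : SimpleGraph V}
  (gates : Set (QuotientHalfEdge G 𝒯)) (T₀ : 𝒯.Subgraph) (B : Set V)

/-- A pair `(T, f)` of an admissible tree `T` containing the base tree `T₀` and a rigid permutation
`f` fixing `B` pointwise. -/
structure TreePair where
  /-- the tree -/
  tree : 𝒯.Subgraph
  admissible : IsAdmissible gates tree
  base_le : T₀ ≤ tree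
  /-- the rigid permutation -/
  perm : Equiv.Perm V
  perm_mem : perm ∈ rigidPermutations G 𝒯 B

variable {gates T₀ B}

/-- `(T, f) ∼ (S, g)`: `g⁻¹ ∘ f` restricts to a bijection from the vertices of `T` to those of `S`
and has the interior of `T` as a support. -/
def TreePair.Equivalent (p q : TreePair gates T₀ B) : Prop :=
  Set.BijOn (q.perm⁻¹ * p.perm) p.tree.verts q.tree.verts ∧
    IsRigidSupport G 𝒯 (q.perm⁻¹ * p.perm) (interiorVerts p.tree)

variable (gates T₀ B)

/-- The set of classes `[T, f]`. -/
def TreeClass : Type _ := Quot (TreePair.Equivalent (gates := gates) (T₀ := T₀) (B := B))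

variable {gates T₀ B}

/-- The class `[T, f]`. -/
def TreePair.toClass (p : TreePair gates T₀ B) : TreeClass gates T₀ B := Quot.mk _ p

/-- `x ≤ y`: `x = [T, f]` and `y = [T', f]` with `T ⊆ T'`. -/
def TreeClass.Le (x y : TreeClass gates T₀ B) : Prop :=
  ∃ p q : TreePair gates T₀ B, p.toClass = x ∧ q.toClass = y ∧ p.perm = q.perm ∧ p.tree ≤ q.tree

/-- `x ≼ y`: `x = [T, f]` and `y = [T', f]` with `T'` an elementary expansion of `T`. -/
def TreeClass.ElemLe (x y : TreeClass gates T₀ B) : Prop :=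
  ∃ p q : TreePair gates T₀ B, p.toClass = x ∧ q.toClass = y ∧ p.perm = q.perm ∧
    IsElementaryExpansion gates p.tree q.tree

/-- Elementary simplices `v₀ < ⋯ < vₙ`: finite nonempty chains whose least element `a = v₀` and
greatest element `b = vₙ` satisfy `a ≼ b`. -/
def IsElementarySimplex (s : Finset (TreeClass gates T₀ B)) : Prop :=
  IsChain TreeClass.Le (s : Set (TreeClass gates T₀ B)) ∧
    ∃ a ∈ s, ∃ b ∈ s, (∀ v ∈ s, TreeClass.Le a v ∧ TreeClass.Le v b) ∧ TreeClass.ElemLe a b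

lemma isElementarySimplex_singleton (x : TreeClass gates T₀ B) :
    IsElementarySimplex ({x} : Finset (TreeClass gates T₀ B)) := by
  obtain ⟨p, hp⟩ : ∃ p : TreePair gates T₀ B, p.toClass = x := Quot.exists_rep x
  have hle : TreeClass.Le x x := ⟨p, p, hp, hp, rfl, le_rfl⟩
  refine ⟨by simp, x, Finset.mem_singleton_self x, x, Finset.mem_singleton_self x, ?_,
    ⟨p, p, hp, hp, rfl, Relation.ReflTransGen.refl⟩⟩
  intro v hv
  rw [Finset.mem_singleton] at hv
  subst hv
  exact ⟨hle, hle⟩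

variable (gates T₀ B)

/-- The Stein complex: the simplicial complex formed by the elementary simplices. (Nonempty subsets
of elementary simplices are elementary again; listing them makes this a complex by definition.) -/
def steinComplex : AbstractSimplicialComplex (TreeClass gates T₀ B) where
  faces := {t | t.Nonempty ∧ ∃ s, IsElementarySimplex s ∧ t ⊆ s}
  isRelLowerSet_faces := fun _ ht =>
    ⟨ht.1, fun _ hu hne => ⟨hne, ht.2.imp fun _ hs => ⟨hs.1, hu.trans hs.2⟩⟩⟩
  singleton_mem := fun v =>
    ⟨Finset.singleton_nonempty v, {v}, isElementarySimplex_singleton v, subset_rfl⟩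

end Stein

end RigidPerm

/-! The argument separates a topological criterion for ordered complexes from the combinatorics of
admissible trees. Criterion (`contractibleSpace_of_greatest_successors`). The relation `≼` is convex
inside the order `≤`, so the simplices are exactly the nonempty finite sets of pairwise
`≼`-comparable classes. Suppose that each `x ≤ y` has a greatest `≼`-successor `e x` below `y`, that
`e` is monotone, and that `e x ≠ x` unless `x = y`. Barycentric mass on the part of the complex
below `y` can then be pushed along `e`. It has to be moved from the bottom up, because an unmoved
vertex `x` need not span a simplex with `e x'` for `x' > x`. An integer rank bounds the number of
rounds needed to bring all mass to `y`, so the part below `y` is contractible. In a directed order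
every finite set of vertices lies below some `y`. With monotonically chosen bounds as carriers, the
identity extends over the cone of the complex, which contracts the whole complex. Combinatorics. For
an admissible vertex set `T` let `fullHull T` be the least admissible set having all of `T` in its
interior; it exists because intersections of admissible sets with two common vertices are
admissible. The elementary expansions of `T` are exactly the admissible trees between `T` and its
hull. Hence the greatest `≼`-successor of `[T, f]` below `[T', f]` is `[T' ∩ fullHull T, f]`.
Convexity of `≼` and monotonicity of `e` follow from monotonicity of the hull, and the number of
vertices of the tree is a rank. Passing to classes is harmless because a permutation supported on
the interior of `T` moves each branch hanging off `T` by an element of `G`. It therefore carries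
admissible sets containing `T` to admissible sets, and hulls to hulls. Directedness holds because
rigid permutations have finite supports, which fit inside the interior of one large admissible tree.
-/

section

open Set Topology

open scoped unitInterval

/-! ### The weak topology: continuity tests for maps and homotopies. -/

section Realization

variable {ι : Type*} {K : AbstractSimplicialComplex ι}

/-- A point of the realisation whose support lies in `s`, as a point of the closed simplex. -/
def ClosedSimplex.of {s : Finset ι} (x : SimplicialRealization K) (hx : x.1.support ⊆ s) :
    ClosedSimplex K s := ⟨x, hx⟩

theorem SimplicialRealization.continuous_coe_closedSimplex {s : Finset ι} (hs : s ∈ K.faces) :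
    Continuous fun x : ClosedSimplex K s => x.1 :=
  continuous_iSup_rng (i := (⟨s, hs⟩ : {s : Finset ι // s ∈ K.faces})) continuous_coinduced_rng

theorem SimplicialRealization.continuous_iff {Y : Type*} [TopologicalSpace Y]
    {f : SimplicialRealization K → Y} :
    Continuous f ↔ ∀ s ∈ K.faces, Continuous fun x : ClosedSimplex K s => f x.1 := by
  rw [continuous_iSup_dom]
  simp only [continuous_coinduced_dom, Subtype.forall]
  rfl

theorem ClosedSimplex.continuous_coord {s : Finset ι} (v : ι) :
    Continuous fun x : ClosedSimplex K s => x.1.1 v :=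
  (continuous_apply v).comp continuous_induced_dom

theorem ClosedSimplex.continuous_of_coord {s : Finset ι} {Z : Type*} [TopologicalSpace Z]
    {f : Z → ClosedSimplex K s} (h : ∀ v, Continuous fun z => (f z).1.1 v) : Continuous f :=
  continuous_induced_rng.2 (continuous_pi h)

/-- A map to the realisation with finitely many vertices in play is continuous as soon as its
barycentric coordinates are. -/
theorem SimplicialRealization.continuous_of_coord {Z : Type*} [TopologicalSpace Z]
    {f : Z → SimplicialRealization K} (W : Finset ι) (hW : ∀ z, (f z).1.support ⊆ W)
    (h : ∀ v, Continuous fun z => (f z).1 v) : Continuous f := by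
  classical
  -- Finitely many closed pieces, one for each face inside `W`; on each of them `f` factors through
  -- a single closed simplex.
  let c : {s : Finset ι // s ∈ W.powerset ∧ s ∈ K.faces} → Set Z := fun s => {z | (f z).1.support ⊆ s.1}
  have hfin : Finite {s : Finset ι // s ∈ W.powerset ∧ s ∈ K.faces} :=
    Finite.of_injective (β := {s // s ∈ W.powerset}) (fun s => ⟨s.1, s.2.1⟩)
      fun a b hab => Subtype.ext (congrArg (fun x => x.1) hab)
  have hcl : ∀ s, IsClosed (c s) := by
    intro s
    have : c s = ⋂ v ∈ {v | v ∉ s.1}, {z | (f z).1 v = 0} := by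
      ext z
      simp only [c, mem_ofPred_eq, mem_iInter, Finset.subset_iff, Finsupp.mem_support_iff]
      exact forall_congr' fun v => not_imp_comm
    rw [this]
    exact isClosed_biInter fun v _ => isClosed_eq (h v) continuous_const
  have hcov : ⋃ s, c s = univ := by
    refine eq_univ_of_forall fun z => mem_iUnion.2 ?_
    exact ⟨⟨(f z).1.support, Finset.mem_powerset.2 (hW z), (f z).2.2.2⟩, Finset.Subset.refl (f z).1.support⟩
  refine (locallyFinite_of_finite c).continuous hcov hcl fun s => ?_
  rw [continuousOn_iff_continuous_domRestrict]
  have : Continuous fun z : c s => ClosedSimplex.of (s := s.1) (f z.1) z.2 :=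
    ClosedSimplex.continuous_of_coord fun v => (h v).comp continuous_subtype_val
  exact (continuous_coe_closedSimplex s.2.2).comp this

/-- Currying reduces the product with `I` to the weak topology: the map into `C(I, Y)` can be tested
on closed simplices, and local compactness of `I` permits uncurrying. -/
theorem SimplicialRealization.continuous_homotopy {Y : Type*} [TopologicalSpace Y]
    {H : SimplicialRealization K → I → Y}
    (h : ∀ s ∈ K.faces, Continuous fun p : ClosedSimplex K s × I => H p.1.1 p.2) :
    Continuous fun p : SimplicialRealization K × I => H p.1 p.2 := by
  have hx : ∀ x, Continuous (H x) := fun x =>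
    (h x.1.support x.2.2.2).comp
      (Continuous.prodMk (continuous_const (y := ClosedSimplex.of x subset_rfl)) continuous_id)
  let F : SimplicialRealization K → C(I, Y) := fun x => ⟨H x, hx x⟩
  have hF : Continuous F := by
    rw [continuous_iff]
    intro s hs
    exact ContinuousMap.continuous_of_continuous_uncurry _ (h s hs)
  exact ContinuousMap.continuous_uncurry_of_continuous ⟨F, hF⟩

variable (K) in
/-- The realisation of the full subcomplex on a set of vertices, as a subspace. -/
def fullSubcomplex (S : Set ι) : Set (SimplicialRealization K) := {x | (x.1.support : Set ι) ⊆ S}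

theorem fullSubcomplex_mono {S S' : Set ι} (h : S ⊆ S') :
    fullSubcomplex K S ⊆ fullSubcomplex K S' := fun _ hx => hx.trans h

/-- The inclusion of the closed simplex of a face into a full subcomplex containing it. -/
def ClosedSimplex.toFull {S : Set ι} {s : Finset ι} (hS : (s : Set ι) ⊆ S)
    (x : ClosedSimplex K s) : fullSubcomplex K S :=
  ⟨x.1, (Finset.coe_subset.2 x.2).trans hS⟩

/-- The subspace topology is no coarser than the weak topology of the subcomplex: a closed simplex
of `s` meets the subcomplex in the closed face spanned by `s ∩ S`, so a set closed in all simplices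
of the subcomplex is closed in the whole realisation. -/
theorem fullSubcomplex.continuous {S : Set ι} {Y : Type*} [TopologicalSpace Y]
    {f : fullSubcomplex K S → Y}
    (h : ∀ s ∈ K.faces, ∀ hS : (s : Set ι) ⊆ S, Continuous fun x : ClosedSimplex K s =>
      f (x.toFull hS)) : Continuous f := by
  classical
  rw [continuous_iff_isClosed]
  intro A hA
  rw [isClosed_induced_iff]
  refine ⟨Subtype.val '' (f ⁻¹' A), ?_, preimage_image_eq _ Subtype.val_injective⟩
  rw [isClosed_iSup_iff]
  rintro ⟨s, hs⟩
  rw [isClosed_coinduced]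
  let s' : Finset ι := s.filter (· ∈ S)
  have hs'S : (s' : Set ι) ⊆ S := fun v hv => (Finset.mem_filter.1 hv).2
  have hsupp : ∀ x : ClosedSimplex K s, x.1 ∈ fullSubcomplex K S → x.1.1.support ⊆ s' :=
    fun x hx v hv => Finset.mem_filter.2 ⟨x.2 hv, hx hv⟩
  by_cases hne : s'.Nonempty
  · have hs' : s' ∈ K.faces := (K.isRelLowerSet_faces hs).2 (Finset.filter_subset _ _) hne
    let j : ClosedSimplex K s' → ClosedSimplex K s :=
      fun x => .of x.1 (x.2.trans (Finset.filter_subset _ _))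
    have hj : IsClosedEmbedding j := by
      refine ⟨⟨⟨?_⟩, fun a b hab => Subtype.ext (congrArg (fun x => x.1) hab)⟩, ?_⟩
      · exact (induced_compose (f := j) (g := fun (x : ClosedSimplex K s) (v : ι) => x.1.1 v)).symm
      · have : range j = ⋂ v ∈ {v | v ∉ s'}, {x : ClosedSimplex K s | x.1.1 v = 0} := by
          ext x
          simp only [mem_range, mem_ofPred_eq, mem_iInter]
          constructor
          · rintro ⟨z, rfl⟩ v hv
            by_contra h0
            exact hv (z.2 (Finsupp.mem_support_iff.2 h0))
          · intro hx
            refine ⟨.of x.1 fun v hv => ?_, rfl⟩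
            by_contra h0
            exact Finsupp.mem_support_iff.1 hv (hx v h0)
        rw [this]
        exact isClosed_biInter fun v _ =>
          isClosed_eq (ClosedSimplex.continuous_coord v) continuous_const
    have : (fun x : ClosedSimplex K s => x.1) ⁻¹' (Subtype.val '' (f ⁻¹' A)) =
        j '' ((fun x : ClosedSimplex K s' => f (x.toFull hs'S)) ⁻¹' A) := by
      ext x
      constructor
      · rintro ⟨z, hz, hzx⟩
        have hxS : x.1 ∈ fullSubcomplex K S := by
          have h1 := z.2
          rwa [hzx] at h1
        refine ⟨.of x.1 (hsupp x hxS), ?_, rfl⟩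
        have : z = (⟨x.1, hxS⟩ : fullSubcomplex K S) := Subtype.ext hzx
        rw [this] at hz
        exact hz
      · rintro ⟨z, hz, rfl⟩
        exact ⟨_, hz, rfl⟩
    rw [this]
    exact hj.isClosedMap _ (hA.preimage (h s' hs' hs'S))
  · convert isClosed_empty
    refine eq_empty_of_forall_notMem ?_
    rintro x ⟨z, -, hzx⟩
    have hxS : x.1 ∈ fullSubcomplex K S := by
          have h1 := z.2
          rwa [hzx] at h1
    have := hsupp x hxS
    rw [Finset.not_nonempty_iff_eq_empty.1 hne, Finset.subset_empty] at this
    have h1 := (K.isRelLowerSet_faces x.1.2.2.2).1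
    rw [this] at h1
    exact Finset.not_nonempty_empty h1

theorem fullSubcomplex.continuous_homotopy {S : Set ι} {Y : Type*} [TopologicalSpace Y]
    {H : fullSubcomplex K S → I → Y}
    (h : ∀ s ∈ K.faces, ∀ hS : (s : Set ι) ⊆ S, Continuous fun p : ClosedSimplex K s × I =>
      H (p.1.toFull hS) p.2) :
    Continuous fun p : fullSubcomplex K S × I => H p.1 p.2 := by
  have hx : ∀ x, Continuous (H x) := fun x =>
    (h x.1.1.support x.1.2.2.2 x.2).comp
      (Continuous.prodMk (continuous_const (y := ClosedSimplex.of x.1 subset_rfl)) continuous_id)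
  let F : fullSubcomplex K S → C(I, Y) := fun x => ⟨H x, hx x⟩
  have hF : Continuous F := fullSubcomplex.continuous fun s hs hS =>
    ContinuousMap.continuous_of_continuous_uncurry _ (h s hs hS)
  exact ContinuousMap.continuous_uncurry_of_continuous ⟨F, hF⟩

end Realization

end

section

open Set Topology

open scoped unitInterval

/-! ### Extension of maps over contractible carriers. -/

section Extension

variable {ι : Type*} {K : AbstractSimplicialComplex ι}

/-- The smallest barycentric coordinate with respect to the face `s`. -/
noncomputable def minCoord {s : Finset ι} (hs : s ∈ K.faces) (x : SimplicialRealization K) : ℝ :=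
  s.inf' (K.isRelLowerSet_faces hs).1 fun v => x.1 v

theorem minCoord_le {s : Finset ι} (hs : s ∈ K.faces) (x : SimplicialRealization K) {v : ι}
    (hv : v ∈ s) : minCoord hs x ≤ x.1 v := Finset.inf'_le _ hv

theorem exists_minCoord_eq {s : Finset ι} (hs : s ∈ K.faces) (x : SimplicialRealization K) :
    ∃ v ∈ s, x.1 v = minCoord hs x :=
  let ⟨v, hv, h⟩ := Finset.exists_mem_eq_inf' (K.isRelLowerSet_faces hs).1 fun v => x.1 v
  ⟨v, hv, h.symm⟩

theorem minCoord_nonneg {s : Finset ι} (hs : s ∈ K.faces) (x : SimplicialRealization K) :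
    0 ≤ minCoord hs x := by
  obtain ⟨v, -, h⟩ := exists_minCoord_eq hs x
  exact h ▸ x.2.1 v

theorem minCoord_eq_zero {s : Finset ι} (hs : s ∈ K.faces) {x : SimplicialRealization K}
    (hx : x.1.support ⊂ s) : minCoord hs x = 0 := by
  obtain ⟨v, hv, h⟩ := Finset.exists_of_ssubset hx
  refine le_antisymm ?_ (minCoord_nonneg hs x)
  rw [← Finsupp.notMem_support_iff.1 h]
  exact minCoord_le hs x hv

theorem continuous_minCoord {s : Finset ι} (hs : s ∈ K.faces) :
    Continuous fun x : ClosedSimplex K s => minCoord hs x.1 :=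
  Continuous.finset_inf'_apply _ fun v _ => ClosedSimplex.continuous_coord v

theorem SimplicialRealization.sum_eq_one {s : Finset ι} {x : SimplicialRealization K}
    (hx : x.1.support ⊆ s) : ∑ v ∈ s, x.1 v = 1 :=
  (Finsupp.sum_of_support_subset x.1 hx (fun _ t => t) fun _ _ => rfl).symm.trans x.2.2.1

/-- Radial projection of the closed simplex of `s` from its barycentre to its boundary. -/
noncomputable def radialProj {s : Finset ι} (hs : s ∈ K.faces) (x : SimplicialRealization K)
    (hx : x.1.support ⊆ s) (h : s.card * minCoord hs x < 1) : SimplicialRealization K := by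
  classical
  let y : ι →₀ ℝ := Finsupp.onFinset s
    (fun v => if v ∈ s then (x.1 v - minCoord hs x) / (1 - s.card * minCoord hs x) else 0)
    fun v hv => by by_contra h; exact hv (if_neg h)
  have hsum : y.sum (fun _ t => t) = 1 := by
    rw [Finsupp.sum_of_support_subset y Finsupp.support_onFinset_subset _ fun _ _ => rfl]
    have : ∀ v ∈ s, y v = (x.1 v - minCoord hs x) / (1 - s.card * minCoord hs x) :=
      fun v hv => if_pos hv
    rw [Finset.sum_congr rfl this, ← Finset.sum_div, Finset.sum_sub_distrib,
      SimplicialRealization.sum_eq_one hx, Finset.sum_const, nsmul_eq_mul, div_self]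
    linarith
  refine ⟨y, fun v => ?_, hsum, ?_⟩
  · change 0 ≤ if v ∈ s then (x.1 v - minCoord hs x) / (1 - s.card * minCoord hs x) else 0
    split_ifs with hv
    · exact div_nonneg (sub_nonneg.2 (minCoord_le hs x hv)) (by linarith)
    · exact le_rfl
  · refine (K.isRelLowerSet_faces hs).2 Finsupp.support_onFinset_subset ?_
    by_contra h0
    rw [Finset.not_nonempty_iff_eq_empty, Finsupp.support_eq_empty] at h0
    rw [h0, Finsupp.sum_zero_index] at hsum
    exact zero_ne_one hsum

theorem radialProj_apply {s : Finset ι} (hs : s ∈ K.faces) (x : SimplicialRealization K)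
    (hx : x.1.support ⊆ s) (h : s.card * minCoord hs x < 1) {v : ι} (hv : v ∈ s) :
    (radialProj hs x hx h).1 v = (x.1 v - minCoord hs x) / (1 - s.card * minCoord hs x) :=
  if_pos hv

theorem radialProj_apply_of_notMem {s : Finset ι} (hs : s ∈ K.faces) (x : SimplicialRealization K)
    (hx : x.1.support ⊆ s) (h : s.card * minCoord hs x < 1) {v : ι} (hv : v ∉ s) :
    (radialProj hs x hx h).1 v = 0 :=
  if_neg hv

open Classical in
theorem support_radialProj_subset {s : Finset ι} (hs : s ∈ K.faces) (x : SimplicialRealization K)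
    (hx : x.1.support ⊆ s) (h : s.card * minCoord hs x < 1) {v : ι}
    (hv : x.1 v = minCoord hs x) : (radialProj hs x hx h).1.support ⊆ s \ {v} := by
  intro w hw
  rw [Finsupp.mem_support_iff] at hw
  have hws : w ∈ s := by
    by_contra h0
    exact hw (radialProj_apply_of_notMem hs x hx h h0)
  refine Finset.mem_sdiff.2 ⟨hws, fun hwv => hw ?_⟩
  rw [radialProj_apply hs x hx h hws, Finset.mem_singleton.1 hwv, hv, sub_self, zero_div]

theorem support_radialProj_ssubset {s : Finset ι} (hs : s ∈ K.faces) (x : SimplicialRealization K)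
    (hx : x.1.support ⊆ s) (h : s.card * minCoord hs x < 1) :
    (radialProj hs x hx h).1.support ⊂ s := by
  classical
  obtain ⟨v, hv, hvm⟩ := exists_minCoord_eq hs x
  refine (support_radialProj_subset hs x hx h hvm).trans_ssubset ?_
  exact Finset.sdiff_ssubset (Finset.singleton_subset_iff.2 hv) (Finset.singleton_nonempty v)

theorem radialProj_eq_self {s : Finset ι} (hs : s ∈ K.faces) (x : SimplicialRealization K)
    (hx : x.1.support ⊆ s) (h : s.card * minCoord hs x < 1) (h0 : minCoord hs x = 0) :
    radialProj hs x hx h = x := by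
  refine Subtype.ext (Finsupp.ext fun v => ?_)
  by_cases hv : v ∈ s
  · rw [radialProj_apply hs x hx h hv, h0]; simp
  · rw [radialProj_apply_of_notMem hs x hx h hv]
    exact (Finsupp.notMem_support_iff.1 fun h' => hv (hx h')).symm

/-- A contraction that has already reached its constant value at time `1 / 2`. -/
theorem exists_contraction (Y : Type*) [TopologicalSpace Y] [ContractibleSpace Y] :
    ∃ (c : ℝ × Y → Y) (z : Y), Continuous c ∧ (∀ y, c (0, y) = y) ∧
      ∀ t y, 1 / 2 ≤ t → c (t, y) = z := by
  obtain ⟨z, ⟨H⟩⟩ := id_nullhomotopic Y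
  refine ⟨fun p => H (projIcc 0 1 zero_le_one (2 * p.1), p.2), z, ?_, fun y => ?_, fun t y ht => ?_⟩
  · exact H.continuous.comp ((continuous_projIcc.comp (continuous_const.mul continuous_fst)).prodMk
      continuous_snd)
  · simp only [mul_zero]
    rw [projIcc_of_le_left zero_le_one le_rfl]
    exact H.apply_zero y
  · simp only
    rw [projIcc_of_right_le zero_le_one (by linarith)]
    exact H.apply_one y

/-- Extension over contractible carriers: a map defined on a subcomplex and carried by a monotone
family of contractible subspaces extends to the whole complex. -/
theorem exists_continuous_extension {Y : Type*} [TopologicalSpace Y] (D : Set (Finset ι))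
    (hD : ∀ s t, s ⊆ t → t ∈ D → s ∈ D) (C : Finset ι → Set Y) (hC : ∀ s t, s ⊆ t → C s ⊆ C t)
    (hcontr : ∀ s ∈ K.faces, s ∉ D → ContractibleSpace (C s)) (f : SimplicialRealization K → Y)
    (hf : ∀ x, x.1.support ∈ D → f x ∈ C x.1.support)
    (hfc : ∀ s ∈ K.faces, s ∈ D → Continuous fun x : ClosedSimplex K s => f x.1) :
    ∃ F : SimplicialRealization K → Y, Continuous F ∧ ∀ x, x.1.support ∈ D → F x = f x := by
  classical
  have key : ∀ s : Finset ι, s ∈ K.faces → s ∉ D → ∃ (c : ℝ × C s → C s) (z : C s),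
      Continuous c ∧ (∀ y, c (0, y) = y) ∧ ∀ t y, 1 / 2 ≤ t → c (t, y) = z := fun s hs hsD =>
    have := hcontr s hs hsD
    exists_contraction (C s)
  choose c z hcc hc0 hc1 using key
  -- Recursion on the dimension of the open simplex containing `x`: project `x` radially to the
  -- boundary, take the value already defined there, and contract inside the carrier for time `card
  -- * minCoord`. This time is `0` on the boundary and `1` at the barycentre, where the projection
  -- is undefined and the final constant is used.
  let step : ∀ x : SimplicialRealization K,
      (∀ y : SimplicialRealization K, y.1.support.card < x.1.support.card → C y.1.support) →
      C x.1.support := fun x rec =>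
    if hxD : x.1.support ∈ D then ⟨f x, hf x hxD⟩ else
    if h : x.1.support.card * minCoord x.2.2.2 x < 1 then
      have hss := support_radialProj_ssubset x.2.2.2 x subset_rfl h
      c _ x.2.2.2 hxD (x.1.support.card * minCoord x.2.2.2 x,
        ⟨(rec (radialProj x.2.2.2 x subset_rfl h) (Finset.card_lt_card hss)).1,
          hC _ _ hss.1 (Subtype.prop _)⟩)
    else z _ x.2.2.2 hxD
  let wf := (measure fun x : SimplicialRealization K => x.1.support.card).wf
  let F : ∀ x : SimplicialRealization K, C x.1.support := wf.fix step
  have hF : ∀ x, F x = step x fun y _ => F y := fun x => wf.fix_eq step x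
  have hFD : ∀ x, x.1.support ∈ D → (F x).1 = f x := by
    intro x hx
    rw [hF]
    simp only [step, dif_pos hx]
  -- The recursive formula holds on the whole closed simplex of `s`, not only on its interior: on
  -- the boundary the projection is the identity and the contraction is at time `0`.
  have hlt : ∀ {s : Finset ι} (hs : s ∈ K.faces) (hsD : s ∉ D) (x : SimplicialRealization K)
      (hx : x.1.support ⊆ s) (h : s.card * minCoord hs x < 1),
      (F x).1 = c s hs hsD (s.card * minCoord hs x, ⟨(F (radialProj hs x hx h)).1,
        hC _ _ (support_radialProj_ssubset hs x hx h).1 (Subtype.prop _)⟩) := by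
    intro s hs hsD x hx h
    rcases hx.eq_or_ssubset with rfl | hss
    · rw [hF]
      simp only [step, dif_neg hsD, dif_pos h]
    · have h0 := minCoord_eq_zero hs hss
      have : ∀ (t : ℝ) (y : C s), t = 0 → c s hs hsD (t, y) = y := by
        rintro t y rfl
        exact hc0 s hs hsD y
      rw [this _ _ (by rw [h0, mul_zero])]
      change (F x).1 = (F (radialProj hs x hx h)).1
      rw [radialProj_eq_self hs x hx h h0]
  have hge : ∀ {s : Finset ι} (hs : s ∈ K.faces) (hsD : s ∉ D) (x : SimplicialRealization K)
      (_ : x.1.support ⊆ s) (_ : 1 / 2 ≤ s.card * minCoord hs x), (F x).1 = z s hs hsD := by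
    intro s hs hsD x hx h
    by_cases h1 : s.card * minCoord hs x < 1
    · rw [hlt hs hsD x hx h1, hc1 s hs hsD _ _ h]
    · rcases hx.eq_or_ssubset with rfl | hss
      · rw [hF]
        simp only [step, dif_neg hsD, dif_neg h1]
      · rw [minCoord_eq_zero hs hss, mul_zero] at h1
        exact absurd zero_lt_one h1
  refine ⟨fun x => (F x).1, ?_, hFD⟩
  rw [SimplicialRealization.continuous_iff]
  intro s
  induction s using Finset.strongInduction with
  | H s ih =>
    intro hs
    by_cases hsD : s ∈ D
    · convert hfc s hs hsD using 2 with x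
      exact hFD x.1 (hD _ _ x.2 hsD)
    have hρ : Continuous fun x : ClosedSimplex K s => s.card * minCoord hs x.1 :=
      continuous_const.mul (continuous_minCoord hs)
    rw [continuous_iff_continuousAt]
    intro x
    -- Past time `1 / 2` the map is constant, so the singularity of the projection at the barycentre
    -- is harmless; up to time `1 / 2` the projection is defined in a neighbourhood.
    rcases lt_or_ge (1 / 2 : ℝ) (s.card * minCoord hs x.1) with hx | hx
    · have hU : {x : ClosedSimplex K s | 1 / 2 < s.card * minCoord hs x.1} ∈ 𝓝 x :=
        (isOpen_lt continuous_const hρ).mem_nhds hx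
      refine (continuousAt_const (y := (z s hs hsD).1)).congr ?_
      filter_upwards [hU] with y hy
      exact (hge hs hsD y.1 y.2 (le_of_lt hy)).symm
    · let U : Set (ClosedSimplex K s) := {x | s.card * minCoord hs x.1 < 1}
      have hU : U ∈ 𝓝 x := (isOpen_lt hρ continuous_const).mem_nhds (by
        change (s.card : ℝ) * minCoord hs x.1 < 1
        linarith)
      let π : U → SimplicialRealization K := fun y => radialProj hs y.1.1 y.1.2 y.2
      have hπ : ∀ v, Continuous fun y : U => (π y).1 v := by
        intro v
        by_cases hv : v ∈ s
        · have : (fun y : U => (π y).1 v) = fun y : U =>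
              (y.1.1.1 v - minCoord hs y.1.1) / (1 - s.card * minCoord hs y.1.1) :=
            funext fun y => radialProj_apply hs y.1.1 y.1.2 y.2 hv
          rw [this]
          refine Continuous.div ?_ ?_ fun y => ?_
          · exact ((ClosedSimplex.continuous_coord v).sub (continuous_minCoord hs)).comp
              continuous_subtype_val
          · exact (continuous_const.sub hρ).comp continuous_subtype_val
          · have : s.card * minCoord hs y.1.1 < 1 := y.2
            linarith
        · have : (fun y : U => (π y).1 v) = fun y : U => 0 :=
            funext fun y => radialProj_apply_of_notMem hs y.1.1 y.1.2 y.2 hv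
          rw [this]
          exact continuous_const
      have hFπ : Continuous fun y : U => (F (π y)).1 := by
        -- Where `v` attains the minimal coordinate, the projection lands in the face opposite `v`,
        -- and the induction hypothesis applies to that face.
        let W : s → Set U := fun v => {y | y.1.1.1 v = minCoord hs y.1.1}
        refine (locallyFinite_of_finite W).continuous ?_ (fun v => ?_) fun v => ?_
        · refine eq_univ_of_forall fun y => ?_
          obtain ⟨v, hv, h⟩ := exists_minCoord_eq hs y.1.1
          exact mem_iUnion.2 ⟨⟨v, hv⟩, h⟩
        · exact isClosed_eq ((ClosedSimplex.continuous_coord v.1).comp continuous_subtype_val)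
            ((continuous_minCoord hs).comp continuous_subtype_val)
        · rw [continuousOn_iff_continuous_domRestrict]
          have hsupp : ∀ y : W v, (π y.1).1.support ⊆ s \ {v.1} := fun y =>
            support_radialProj_subset hs y.1.1.1 y.1.1.2 y.1.2 y.2
          rcases isEmpty_or_nonempty (W v) with hW | ⟨⟨y⟩⟩
          · exact continuous_of_const fun y => hW.elim y
          have hsv : s \ {v.1} ∈ K.faces := (K.isRelLowerSet_faces hs).2 Finset.sdiff_subset
            ((K.isRelLowerSet_faces (π y.1).2.2.2).1.mono (hsupp y))
          have h1 := ih _ (Finset.sdiff_ssubset (Finset.singleton_subset_iff.2 v.2)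
            (Finset.singleton_nonempty v.1)) hsv
          have h2 : Continuous fun y : W v => ClosedSimplex.of (π y.1) (hsupp y) :=
            ClosedSimplex.continuous_of_coord fun w => (hπ w).comp continuous_subtype_val
          exact h1.comp h2
      have hFU : ContinuousOn (fun y : ClosedSimplex K s => (F y.1).1) U := by
        rw [continuousOn_iff_continuous_domRestrict]
        have : U.domRestrict (fun y : ClosedSimplex K s => (F y.1).1) = fun y : U =>
            (c s hs hsD (s.card * minCoord hs y.1.1, ⟨(F (π y)).1,
              hC _ _ (support_radialProj_ssubset hs y.1.1 y.1.2 y.2).1 (Subtype.prop _)⟩)).1 :=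
          funext fun y => hlt hs hsD y.1.1 y.1.2 y.2
        rw [this]
        exact continuous_subtype_val.comp ((hcc s hs hsD).comp
          ((hρ.comp continuous_subtype_val).prodMk (hFπ.subtype_mk _)))
      exact hFU.continuousAt hU

end Extension

end

section

open Set Topology

open scoped unitInterval

/-- The vertex `v` as a point of the realisation. -/
noncomputable def SimplicialRealization.vertex {ι : Type*} (K : AbstractSimplicialComplex ι)
    (v : ι) : SimplicialRealization K :=
  ⟨Finsupp.single v 1, fun w => (Finsupp.single_nonneg.2 zero_le_one : _) w,
    Finsupp.sum_single_index rfl, by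
      rw [Finsupp.support_single v one_ne_zero]; exact K.singleton_mem v⟩

theorem SimplicialRealization.coe_vertex {ι : Type*} (K : AbstractSimplicialComplex ι) (v : ι) :
    (SimplicialRealization.vertex K v).1 = Finsupp.single v 1 := rfl

theorem Finsupp.mapDomain_eq_single {ι : Type*} {p : ι →₀ ℝ} (h1 : p.sum (fun _ r => r) = 1)
    {g : ι → ι} {y : ι} (hg : ∀ x ∈ p.support, g x = y) :
    p.mapDomain g = Finsupp.single y 1 := by
  rw [← h1, Finsupp.sum, Finsupp.single_finsetSum]
  exact Finset.sum_congr rfl fun x hx => by simp only [hg x hx]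

/-! ### Moving barycentric mass along a self-map, lowest vertices first. -/

section MassTransport

variable {P : Type*} [PartialOrder P]

open Classical in
/-- The mass that has left `x` at time `t` when the mass of `p` is moved from the bottom up. -/
noncomputable def movedMass (p : P →₀ ℝ) (t : ℝ) (x : P) : ℝ :=
  min (max (t - ∑ z ∈ p.support with z < x, p z) 0) (p x)

open Classical in
theorem movedMass_eq {p : P →₀ ℝ} {s : Finset P} (h : p.support ⊆ s) (t : ℝ) (x : P) :
    movedMass p t x = min (max (t - ∑ z ∈ s with z < x, p z) 0) (p x) := by
  rw [movedMass, Finset.sum_subset (Finset.filter_subset_filter _ h)]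
  intro z hz hz'
  by_contra h0
  exact hz' (Finset.mem_filter.2 ⟨Finsupp.mem_support_iff.2 h0, (Finset.mem_filter.1 hz).2⟩)

theorem movedMass_nonneg {p : P →₀ ℝ} (hp : ∀ v, 0 ≤ p v) (t : ℝ) (x : P) :
    0 ≤ movedMass p t x := le_min (le_max_right _ _) (hp x)

theorem movedMass_le (p : P →₀ ℝ) (t : ℝ) (x : P) : movedMass p t x ≤ p x := min_le_right _ _

theorem movedMass_zero {p : P →₀ ℝ} (hp : ∀ v, 0 ≤ p v) (x : P) : movedMass p 0 x = 0 := by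
  rw [movedMass, zero_sub, max_eq_right, min_eq_left (hp x)]
  exact neg_nonpos.2 (Finset.sum_nonneg fun v _ => hp v)

/-- The mass strictly below `x` together with that at `x` is at most the mass of `W`, so by time `t`
the queue at `x` has been emptied. -/
theorem movedMass_eq_self {p : P →₀ ℝ} {t : ℝ} {x : P} {W : Finset P} (hp : ∀ v, 0 ≤ p v)
    (hW : ∀ z ∈ p.support, z ≤ x → z ∈ W) (ht : ∑ z ∈ W, p z ≤ t) : movedMass p t x = p x := by
  classical
  refine min_eq_right (le_max_of_le_left ?_)
  by_cases hx : x ∈ p.support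
  · have : ∑ z ∈ insert x (p.support.filter (· < x)), p z ≤ ∑ z ∈ W, p z := by
      refine Finset.sum_le_sum_of_subset_of_nonneg ?_ fun v _ _ => hp v
      intro z hz
      rcases Finset.mem_insert.1 hz with rfl | hz
      · exact hW _ hx le_rfl
      · exact hW _ (Finset.mem_filter.1 hz).1 (Finset.mem_filter.1 hz).2.le
    rw [Finset.sum_insert (by simp)] at this
    linarith
  · have : ∑ z ∈ p.support.filter (· < x), p z ≤ ∑ z ∈ W, p z := by
      refine Finset.sum_le_sum_of_subset_of_nonneg ?_ fun v _ _ => hp v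
      exact fun z hz => hW _ (Finset.mem_filter.1 hz).1 (Finset.mem_filter.1 hz).2.le
    rw [Finsupp.notMem_support_iff.1 hx]
    linarith

/-- If some mass has left `x'`, then all the mass strictly below `x'` has been moved. -/
theorem movedMass_eq_of_lt {p : P →₀ ℝ} (hp : ∀ v, 0 ≤ p v) {t : ℝ} {x x' : P} (hxx' : x < x')
    (h : 0 < movedMass p t x') : movedMass p t x = p x := by
  classical
  refine movedMass_eq_self (W := p.support.filter (· < x')) hp
    (fun z hz hzx => Finset.mem_filter.2 ⟨hz, hzx.trans_lt hxx'⟩) ?_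
  have h1 := (lt_min_iff.1 h).1
  rcases lt_max_iff.1 h1 with h2 | h2
  · linarith
  · exact absurd h2 (lt_irrefl _)

/-- The mass distribution at time `t` when the mass of `p` is moved along `e` from the bottom up. -/
noncomputable def transport (e : P → P) (p : P →₀ ℝ) (t : ℝ) : P →₀ ℝ :=
  ∑ x ∈ p.support, (Finsupp.single x (p x - movedMass p t x) +
    Finsupp.single (e x) (movedMass p t x))

theorem transport_eq {e : P → P} {p : P →₀ ℝ} {s : Finset P} (hp : ∀ v, 0 ≤ p v)
    (h : p.support ⊆ s) (t : ℝ) :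
    transport e p t = ∑ x ∈ s, (Finsupp.single x (p x - movedMass p t x) +
      Finsupp.single (e x) (movedMass p t x)) := by
  refine Finset.sum_subset h fun x _ hx => ?_
  have h0 := Finsupp.notMem_support_iff.1 hx
  have : movedMass p t x = 0 :=
    le_antisymm ((movedMass_le p t x).trans h0.le) (movedMass_nonneg hp t x)
  rw [this, h0]
  simp

theorem transport_apply (e : P → P) (p : P →₀ ℝ) (t : ℝ) (v : P) :
    transport e p t v = ∑ x ∈ p.support, (Finsupp.single x (p x - movedMass p t x) v +
      Finsupp.single (e x) (movedMass p t x) v) := by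
  simp [transport]

theorem transport_nonneg (e : P → P) {p : P →₀ ℝ} (hp : ∀ v, 0 ≤ p v) (t : ℝ) (v : P) :
    0 ≤ transport e p t v := by
  rw [transport_apply]
  refine Finset.sum_nonneg fun x _ => add_nonneg ?_ ?_
  · exact (Finsupp.single_nonneg.2 (sub_nonneg.2 (movedMass_le p t x)) : _) v
  · exact (Finsupp.single_nonneg.2 (movedMass_nonneg hp t x) : _) v

theorem sum_transport (e : P → P) (p : P →₀ ℝ) (t : ℝ) :
    (transport e p t).sum (fun _ r => r) = p.sum fun _ r => r := by
  rw [transport, ← Finsupp.sum_finsetSum_index (fun _ => rfl) fun _ _ _ => rfl]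
  refine Finset.sum_congr rfl fun x _ => ?_
  rw [Finsupp.sum_add_index' (fun _ => rfl) fun _ _ _ => rfl, Finsupp.sum_single_index rfl,
    Finsupp.sum_single_index rfl]
  ring

theorem transport_zero (e : P → P) {p : P →₀ ℝ} (hp : ∀ v, 0 ≤ p v) : transport e p 0 = p := by
  simp only [transport, movedMass_zero hp, sub_zero, Finsupp.single_zero, add_zero]
  exact p.sum_single

theorem transport_one (e : P → P) {p : P →₀ ℝ} (hp : ∀ v, 0 ≤ p v)
    (h1 : p.sum (fun _ r => r) = 1) : transport e p 1 = p.mapDomain e := by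
  have : ∀ x, movedMass p 1 x = p x := fun x =>
    movedMass_eq_self (W := p.support) hp (fun z hz _ => hz) h1.le
  simp only [transport, this, sub_self, Finsupp.single_zero, zero_add]
  rfl

theorem mem_support_transport {e : P → P} {p : P →₀ ℝ} {t : ℝ} {v : P} (hp : ∀ v, 0 ≤ p v)
    (hv : v ∈ (transport e p t).support) :
    (v ∈ p.support ∧ movedMass p t v < p v) ∨
      ∃ x ∈ p.support, 0 < movedMass p t x ∧ v = e x := by
  classical
  rw [Finsupp.mem_support_iff, transport_apply] at hv
  obtain ⟨x, hx, hxv⟩ := Finset.exists_ne_zero_of_sum_ne_zero hv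
  by_cases h1 : Finsupp.single x (p x - movedMass p t x) v = 0
  · rw [h1, zero_add] at hxv
    right
    rw [Finsupp.single_apply_ne_zero] at hxv
    exact ⟨x, hx, lt_of_le_of_ne (movedMass_nonneg hp t x) hxv.2.symm, hxv.1⟩
  · left
    rw [← ne_eq, Finsupp.single_apply_ne_zero] at h1
    obtain ⟨rfl, h1⟩ := h1
    exact ⟨hx, lt_of_le_of_ne (movedMass_le p t v) fun h => h1 (by rw [h, sub_self])⟩

theorem continuous_transport {Z : Type*} [TopologicalSpace Z] (e : P → P) {s : Finset P}
    {p : Z → P →₀ ℝ} (hp : ∀ z v, 0 ≤ p z v) (hs : ∀ z, (p z).support ⊆ s)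
    (hc : ∀ v, Continuous fun z => p z v) {t : Z → ℝ} (ht : Continuous t) (v : P) :
    Continuous fun z => transport e (p z) (t z) v := by
  classical
  have hm : ∀ x, Continuous fun z => movedMass (p z) (t z) x := by
    intro x
    simp only [fun z => movedMass_eq (hs z) (t z) x]
    exact ((ht.sub (continuous_finsetSum _ fun z _ => hc z)).max continuous_const).min (hc x)
  simp only [fun z => transport_eq (e := e) (hp z) (hs z) (t z), Finsupp.finsetSum_apply,
    Finsupp.add_apply, Finsupp.single_apply]
  refine continuous_finsetSum _ fun x _ => Continuous.add ?_ ?_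
  · split_ifs
    · exact (hc x).sub (hm x)
    · exact continuous_const
  · split_ifs
    · exact hm x
    · exact continuous_const

end MassTransport

/-! ### Contracting a flag complex below a given vertex. -/

section FlagComplex

variable {P : Type*} [PartialOrder P] {R : P → P → Prop} {K : AbstractSimplicialComplex P}

/-- Transporting mass along a greatest-successor function stays inside a flag complex. -/
theorem support_transport_mem_faces
    (hK : ∀ s, s ∈ K.faces ↔ s.Nonempty ∧ ∀ a ∈ s, ∀ b ∈ s, R a b ∨ R b a)
    (hle : ∀ a b, R a b → a ≤ b) (hconv : ∀ a b v w, R a b → a ≤ v → v ≤ w → w ≤ b → R v w)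
    {y : P} {e : P → P} (he_R : ∀ x ≤ y, R x (e x))
    (he_max : ∀ x z, R x z → z ≤ y → z ≤ e x) (he_mono : ∀ x x', x ≤ x' → x' ≤ y → e x ≤ e x')
    (p : SimplicialRealization K) (hpy : ∀ x ∈ p.1.support, x ≤ y) (t : ℝ) :
    (transport e p.1 t).support ∈ K.faces := by
  have hp := p.2.1
  have hpR : ∀ a ∈ p.1.support, ∀ b ∈ p.1.support, R a b ∨ R b a := ((hK _).1 p.2.2.2).2
  rw [hK]
  constructor
  · by_contra h0
    rw [Finset.not_nonempty_iff_eq_empty, Finsupp.support_eq_empty] at h0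
    have h1 := (sum_transport e p.1 t).trans p.2.2.1
    rw [h0, Finsupp.sum_zero_index] at h1
    exact zero_ne_one h1
  · have mixed : ∀ x ∈ p.1.support, movedMass p.1 t x < p.1 x →
        ∀ x' ∈ p.1.support, 0 < movedMass p.1 t x' → R x (e x') := by
      intro x hx hm x' hx' hm'
      have hxx' : x' ≤ x := by
        rcases hpR x hx x' hx' with h | h
        · rcases (hle _ _ h).eq_or_lt with rfl | hlt
          · exact le_rfl
          · exact absurd (movedMass_eq_of_lt hp hlt hm') hm.ne
        · exact hle _ _ h
      have hR : R x' x := by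
        rcases hpR x hx x' hx' with h | h
        · have := le_antisymm hxx' (hle _ _ h)
          rwa [this] at h ⊢
        · exact h
      exact hconv _ _ _ _ (he_R x (hpy x hx)) le_rfl (he_max _ _ hR (hpy x hx))
        (he_mono _ _ hxx' (hpy x hx))
    -- Convexity inside `R x' (e x')`, using `x' ≤ e x ≤ e x'`.
    have moved : ∀ x ∈ p.1.support, ∀ x' ∈ p.1.support, R x x' → R (e x) (e x') := by
      intro x hx x' hx' h
      exact hconv _ _ _ _ (he_R x' (hpy x' hx')) (he_max _ _ h (hpy x' hx'))
        (he_mono _ _ (hle _ _ h) (hpy x' hx')) le_rfl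
    intro a ha b hb
    rcases mem_support_transport hp ha with ⟨ha, hma⟩ | ⟨x, hx, hmx, rfl⟩ <;>
      rcases mem_support_transport hp hb with ⟨hb, hmb⟩ | ⟨x', hx', hmx', rfl⟩
    · exact hpR a ha b hb
    · exact Or.inl (mixed a ha hma x' hx' hmx')
    · exact Or.inr (mixed b hb hmb x hx hmx)
    · exact (hpR x hx x' hx').imp (moved x hx x' hx') (moved x' hx' x hx)

/-- The full subcomplex below `y` is contractible if every `x ≤ y` has a greatest `R`-successor
`e x` below `y`, in a monotone way, and iterating `e` leads to `y`. -/
theorem contractibleSpace_fullSubcomplex_Iic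
    (hK : ∀ s, s ∈ K.faces ↔ s.Nonempty ∧ ∀ a ∈ s, ∀ b ∈ s, R a b ∨ R b a)
    (hle : ∀ a b, R a b → a ≤ b) (hconv : ∀ a b v w, R a b → a ≤ v → v ≤ w → w ≤ b → R v w)
    (y : P) (e : P → P) (he_le : ∀ x ≤ y, e x ≤ y) (he_R : ∀ x ≤ y, R x (e x))
    (he_max : ∀ x z, R x z → z ≤ y → z ≤ e x) (he_mono : ∀ x x', x ≤ x' → x' ≤ y → e x ≤ e x')
    (N : ℕ) (hN : ∀ x ≤ y, e^[N] x = y) :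
    ContractibleSpace (fullSubcomplex K (Iic y)) := by
  classical
  have hface : ∀ (p : fullSubcomplex K (Iic y)) (t : ℝ),
      (transport e p.1.1 t).support ∈ K.faces := fun p t =>
    support_transport_mem_faces hK hle hconv he_R he_max he_mono p.1 (fun x hx => p.2 hx) t
  have hmem : ∀ (p : fullSubcomplex K (Iic y)) (t : ℝ),
      ((transport e p.1.1 t).support : Set P) ⊆ Iic y := by
    intro p t v hv
    rcases mem_support_transport p.1.2.1 hv with ⟨hv, -⟩ | ⟨x, hx, -, rfl⟩
    · exact p.2 hv
    · exact he_le x (p.2 hx)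
  obtain ⟨H, hH, hHt⟩ : ∃ H : fullSubcomplex K (Iic y) → I → fullSubcomplex K (Iic y),
      Continuous (fun q : fullSubcomplex K (Iic y) × I => H q.1 q.2) ∧
      ∀ p t, (H p t).1.1 = transport e p.1.1 t := by
    let H : fullSubcomplex K (Iic y) → I → fullSubcomplex K (Iic y) := fun p t =>
      ⟨⟨transport e p.1.1 t, transport_nonneg e p.1.2.1 t,
        (sum_transport e _ _).trans p.1.2.2.1, hface p t⟩, hmem p t⟩
    refine ⟨H, ?_, fun p t => rfl⟩
    refine fullSubcomplex.continuous_homotopy fun s hs hS => Continuous.subtype_mk ?_ _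
    refine SimplicialRealization.continuous_of_coord (s ∪ s.image e) (fun q v hv => ?_) fun v => ?_
    · rw [Finset.mem_union, Finset.mem_image]
      rcases mem_support_transport q.1.1.2.1 hv with ⟨hv, -⟩ | ⟨x, hx, -, rfl⟩
      · exact Or.inl (q.1.2 hv)
      · exact Or.inr ⟨x, q.1.2 hx, rfl⟩
    · exact continuous_transport e (fun q : ClosedSimplex K s × I => q.1.1.2.1) (fun q => q.1.2)
        (fun v => (ClosedSimplex.continuous_coord v).comp continuous_fst)
        (continuous_subtype_val.comp continuous_snd) v
  let E : C(fullSubcomplex K (Iic y), fullSubcomplex K (Iic y)) :=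
    ⟨fun p => H p 1, hH.comp (continuous_id.prodMk continuous_const)⟩
  have hE : (ContinuousMap.id _).Homotopic E := by
    refine ⟨⟨⟨fun q => H q.2 q.1, hH.comp continuous_swap⟩, fun p => ?_, fun p => rfl⟩⟩
    exact Subtype.ext (Subtype.ext ((hHt p 0).trans (transport_zero e p.1.2.1)))
  -- One transport deforms the identity into the map induced by `e`; iterating gives `e^[n]`, which
  -- for `n = N` is constant at the vertex `y`.
  have hiter : ∀ n : ℕ, ∃ g : C(fullSubcomplex K (Iic y), fullSubcomplex K (Iic y)),
      (ContinuousMap.id _).Homotopic g ∧ ∀ p, (g p).1.1 = p.1.1.mapDomain e^[n] := by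
    intro n
    induction n with
    | zero =>
      exact ⟨ContinuousMap.id _, ContinuousMap.Homotopic.refl _, fun p =>
        (Finsupp.mapDomain_id).symm⟩
    | succ n ih =>
      obtain ⟨g, hg, hgp⟩ := ih
      refine ⟨E.comp g, ?_, fun p => ?_⟩
      · have := ContinuousMap.Homotopic.comp hE hg
        rwa [ContinuousMap.comp_id] at this
      · rw [Function.iterate_succ', Finsupp.mapDomain_comp, ← hgp p]
        exact (hHt (g p) 1).trans (transport_one e (g p).1.2.1 (g p).1.2.2.1)
  obtain ⟨g, hg, hgp⟩ := hiter N
  rw [contractible_iff_id_nullhomotopic]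
  refine ⟨⟨.vertex K y, by simp [fullSubcomplex, SimplicialRealization.coe_vertex]⟩, ?_⟩
  convert hg
  ext1 p
  refine Subtype.ext (Subtype.ext ?_)
  exact (Finsupp.mapDomain_eq_single p.1.2.2.1 fun x hx => hN x (p.2 hx)).symm.trans (hgp p).symm

end FlagComplex

end

section

open Set Topology

open scoped unitInterval

/-! ### The cone on a complex. -/

section Cone

variable {ι : Type*} {K : AbstractSimplicialComplex ι}

variable (K) in
/-- The cone on a simplicial complex, with apex `none`. -/
def coneComplex : AbstractSimplicialComplex (Option ι) where
  faces := {s | s.Nonempty ∧ (s.eraseNone.Nonempty → s.eraseNone ∈ K.faces)}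
  isRelLowerSet_faces := fun _ hs => ⟨hs.1, fun _ ht hne => ⟨hne, fun h =>
    (K.isRelLowerSet_faces (hs.2 (h.mono (Finset.eraseNone.monotone ht)))).2
      (Finset.eraseNone.monotone ht) h⟩⟩
  singleton_mem := fun v => ⟨Finset.singleton_nonempty v, by
    cases v with
    | none => simp
    | some v =>
      have : Finset.eraseNone {some v} = {v} := by ext; simp [eq_comm]
      exact fun _ => this ▸ K.singleton_mem v⟩

theorem Finsupp.support_some {M : Type*} [Zero M] (f : Option ι →₀ M) :
    f.some.support = f.support.eraseNone := by
  ext v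
  simp

/-- The base of the cone. -/
noncomputable def coneBase (x : SimplicialRealization (coneComplex K)) (hx : none ∉ x.1.support) :
    SimplicialRealization K :=
  ⟨x.1.some, fun v => x.2.1 (some v), by
    have h := x.2.2.1
    rw [Finsupp.sum_option_index _ _ (fun _ => rfl) fun _ _ _ => rfl,
      Finsupp.notMem_support_iff.1 hx, zero_add] at h
    exact h, by
    rw [Finsupp.support_some]
    refine x.2.2.2.2 ?_
    obtain ⟨v, hv⟩ := x.2.2.2.1
    cases v with
    | none => exact absurd hv hx
    | some v => exact ⟨v, by simpa using hv⟩⟩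

/-- The point dividing the segment from `p` to the apex of the cone in the ratio `t : 1 - t`. -/
noncomputable def conePoint (p : SimplicialRealization K) (t : I) :
    SimplicialRealization (coneComplex K) :=
  ⟨((1 - t.1) • p.1).optionElim t.1, fun v => by
    cases v with
    | none => simpa using t.2.1
    | some v => simpa using mul_nonneg (sub_nonneg.2 t.2.2) (p.2.1 v), by
    have h := p.2.2.1
    rw [Finsupp.sum_option_index _ _ (fun _ => rfl) fun _ _ _ => rfl, Finsupp.some_optionElim,
      Finsupp.optionElim_apply_none, Finsupp.sum_smul_index fun _ => rfl, ← Finsupp.mul_sum, h]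
    ring, by
    constructor
    · by_contra h0
      rw [Finset.not_nonempty_iff_eq_empty, Finsupp.support_eq_empty] at h0
      have h1 : t.1 = 0 := by simpa using DFunLike.congr_fun h0 none
      have h2 : p.1 = 0 := by
        ext v
        simpa [h1] using DFunLike.congr_fun h0 (some v)
      have h := p.2.2.1
      rw [h2, Finsupp.sum_zero_index] at h
      exact zero_ne_one h
    · rw [← Finsupp.support_some, Finsupp.some_optionElim]
      exact (K.isRelLowerSet_faces p.2.2.2).2 Finsupp.support_smul⟩

theorem conePoint_none (p : SimplicialRealization K) (t : I) : (conePoint p t).1 none = t.1 :=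
  Finsupp.optionElim_apply_none _ _

theorem conePoint_some (p : SimplicialRealization K) (t : I) (v : ι) :
    (conePoint p t).1 (some v) = (1 - t.1) * p.1 v := by
  simp [conePoint]

theorem continuous_conePoint :
    Continuous fun q : SimplicialRealization K × I => conePoint q.1 q.2 := by
  refine SimplicialRealization.continuous_homotopy fun s _ => ?_
  refine SimplicialRealization.continuous_of_coord s.insertNone (fun q v hv => ?_) fun v => ?_
  · cases v with
    | none => simp
    | some v =>
      rw [Finsupp.mem_support_iff, conePoint_some] at hv
      simpa using q.1.2 (Finsupp.mem_support_iff.2 (right_ne_zero_of_mul hv))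
  · cases v with
    | none =>
      simp only [conePoint_none]
      exact continuous_subtype_val.comp continuous_snd
    | some v =>
      simp only [conePoint_some]
      exact (continuous_const.sub (continuous_subtype_val.comp continuous_snd)).mul
        ((ClosedSimplex.continuous_coord v).comp continuous_fst)

end Cone

/-! ### From principal lower sets to a directed order. -/

section Directed

/-- Upper bounds of finite sets in a directed order can be chosen monotonically. -/
theorem exists_monotone_upperBound {P : Type*} [PartialOrder P] [IsDirectedOrder P] (b : P) :
    ∃ u : Finset P → P, Monotone u ∧ (∀ s, ∀ x ∈ s, x ≤ u s) ∧ ∀ s, b ≤ u s := by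
  classical
  have hne : Nonempty P := ⟨b⟩
  have key : ∀ s : Finset P, ∃ y, ∀ x ∈ s, x ≤ y := fun s => s.exists_le
  choose m hm using key
  let wf := (measure fun s : Finset P => s.card).wf
  -- Bounding `s` together with the values already chosen on its proper subsets forces monotonicity.
  let step : ∀ s : Finset P, (∀ t : Finset P, t.card < s.card → P) → P := fun s rec =>
    m (insert b (s ∪ s.ssubsets.attach.image fun t =>
      rec t.1 (Finset.card_lt_card (Finset.mem_ssubsets.1 t.2))))
  let u : Finset P → P := wf.fix step
  have hu : ∀ s, u s = step s fun t _ => u t := fun s => wf.fix_eq step s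
  refine ⟨u, fun s t hst => ?_, fun s x hx => ?_, fun s => ?_⟩
  · rcases hst.eq_or_ssubset with rfl | hss
    · exact le_rfl
    · rw [hu t]
      refine hm _ _ (Finset.mem_insert_of_mem (Finset.mem_union_right _ ?_))
      exact Finset.mem_image.2 ⟨⟨s, Finset.mem_ssubsets.2 hss⟩, Finset.mem_attach _ _, rfl⟩
  · rw [hu s]
    exact hm _ _ (Finset.mem_insert_of_mem (Finset.mem_union_left _ hx))
  · rw [hu s]
    exact hm _ _ (Finset.mem_insert_self _ _)

/-- A complex on a directed order is contractible if all its full subcomplexes on principal lower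
sets are. -/
theorem contractibleSpace_of_directed {P : Type*} [PartialOrder P] [IsDirectedOrder P]
    [Nonempty P] {K : AbstractSimplicialComplex P}
    (h : ∀ y : P, ContractibleSpace (fullSubcomplex K (Iic y))) :
    ContractibleSpace (SimplicialRealization K) := by
  classical
  obtain ⟨b⟩ := ‹Nonempty P›
  obtain ⟨u, humono, hu, hb⟩ := exists_monotone_upperBound b
  let f : SimplicialRealization (coneComplex K) → SimplicialRealization K := fun x =>
    if hx : none ∉ x.1.support then coneBase x hx else .vertex K b
  have hf0 : ∀ x (hx : none ∉ x.1.support), f x = coneBase x hx := fun x hx => dif_pos hx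
  have hf1 : ∀ x, none ∈ x.1.support → f x = .vertex K b := fun x hx => dif_neg (not_not.2 hx)
  obtain ⟨F, hFc, hF⟩ := exists_continuous_extension (K := coneComplex K)
    {s | none ∉ s ∨ s ⊆ {none}}
    (fun s t hst ht => ht.imp (fun h h' => h (hst h')) fun h => hst.trans h)
    (fun s => fullSubcomplex K (Iic (u s.eraseNone)))
    (fun s t hst => fullSubcomplex_mono (Iic_subset_Iic.2 (humono (Finset.eraseNone.monotone hst))))
    (fun s _ _ => h _) f
    (fun x _ => by
      by_cases hx : none ∈ x.1.support
      · rw [hf1 x hx]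
        intro v hv
        have : v = b := by
          by_contra hvb
          exact Finsupp.mem_support_iff.1 hv (Finsupp.single_eq_of_ne hvb)
        exact this ▸ hb _
      · rw [hf0 x hx]
        intro v hv
        refine hu _ v ?_
        rw [← Finsupp.support_some]
        exact hv)
    (fun s hs hsD => by
      by_cases hns : none ∈ s
      · have hs' : s ⊆ {none} := hsD.resolve_left (not_not.2 hns)
        have : ∀ x : ClosedSimplex (coneComplex K) s, f x.1 = .vertex K b := by
          intro x
          refine hf1 _ ?_
          obtain ⟨v, hv⟩ := ((coneComplex K).isRelLowerSet_faces x.1.2.2.2).1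
          rwa [← Finset.mem_singleton.1 (hs' (x.2 hv))]
        simp only [this]
        exact continuous_const
      · have : ∀ x : ClosedSimplex (coneComplex K) s, f x.1 = coneBase x.1 fun h => hns (x.2 h) :=
          fun x => hf0 _ _
        simp only [this]
        refine SimplicialRealization.continuous_of_coord s.eraseNone (fun x => ?_) fun v => ?_
        · change x.1.1.some.support ⊆ _
          rw [Finsupp.support_some]
          exact Finset.eraseNone.monotone x.2
        · exact ClosedSimplex.continuous_coord (some v))
  rw [contractible_iff_id_nullhomotopic]
  refine ⟨.vertex K b, ⟨⟨⟨fun q => F (conePoint q.2 q.1), ?_⟩, fun p => ?_, fun p => ?_⟩⟩⟩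
  · exact hFc.comp (continuous_conePoint.comp continuous_swap)
  · have hn : none ∉ (conePoint p 0).1.support :=
      Finsupp.notMem_support_iff.2 (conePoint_none p 0)
    change F (conePoint p 0) = p
    rw [hF _ (Or.inl hn), hf0 _ hn]
    refine Subtype.ext (Finsupp.ext fun v => ?_)
    change (conePoint p 0).1 (some v) = p.1 v
    rw [conePoint_some]
    simp
  · have hn : none ∈ (conePoint p 1).1.support := by
      rw [Finsupp.mem_support_iff, conePoint_none]
      exact one_ne_zero
    change F (conePoint p 1) = .vertex K b
    rw [hF _ (Or.inr ?_), hf1 _ hn]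
    intro v hv
    cases v with
    | none => exact Finset.mem_singleton_self _
    | some v =>
      rw [Finsupp.mem_support_iff, conePoint_some] at hv
      simp at hv

/-- A flag complex on a directed ranked order, given by a convex relation `R` with greatest
`R`-successors below each upper bound, is contractible. -/
theorem contractibleSpace_of_greatest_successors {P : Type*} [PartialOrder P] [IsDirectedOrder P]
    [Nonempty P] {R : P → P → Prop} {K : AbstractSimplicialComplex P}
    (hK : ∀ s, s ∈ K.faces ↔ s.Nonempty ∧ ∀ a ∈ s, ∀ b ∈ s, R a b ∨ R b a)
    (hle : ∀ a b, R a b → a ≤ b) (hconv : ∀ a b v w, R a b → a ≤ v → v ≤ w → w ≤ b → R v w)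
    (hcore : ∀ x y, x ≤ y → ∃ c, R x c ∧ c ≤ y ∧ (∀ z, R x z → z ≤ y → z ≤ c) ∧ (x ≠ y → x ≠ c))
    (hpush : ∀ x x' y c, x ≤ x' → x' ≤ y → R x c → c ≤ y → ∃ z, R x' z ∧ c ≤ z ∧ z ≤ y)
    (rk : P → ℕ) (hrk : StrictMono rk) :
    ContractibleSpace (SimplicialRealization K) := by
  classical
  refine contractibleSpace_of_directed fun y => ?_
  -- The default `e x = x` for `x` not below `y` only makes `e` total.
  have hcore' : ∀ x, ∃ c, x ≤ y → R x c ∧ c ≤ y ∧ (∀ z, R x z → z ≤ y → z ≤ c) ∧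
      (x ≠ y → x ≠ c) := fun x => by
    by_cases hx : x ≤ y
    · exact (hcore x y hx).imp fun c hc _ => hc
    · exact ⟨x, fun h => absurd h hx⟩
  choose e he using hcore'
  -- Each application of `e` before reaching `y` raises the rank, so `rk y + 1` applications always
  -- suffice.
  have hiter : ∀ x ≤ y, ∀ n, e^[n] x ≤ y ∧ (e^[n] x = y ∨ n ≤ rk (e^[n] x)) := by
    intro x hx n
    induction n with
    | zero => exact ⟨hx, Or.inr (Nat.zero_le _)⟩
    | succ n ih =>
      rw [Function.iterate_succ_apply']
      obtain ⟨h1, h2, -, h4⟩ := he _ ih.1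
      refine ⟨h2, ?_⟩
      by_cases hy : e^[n] x = y
      · left
        rw [hy] at h1 h2 ⊢
        exact le_antisymm h2 (hle _ _ h1)
      · right
        exact (ih.2.resolve_left hy).trans_lt (hrk (lt_of_le_of_ne (hle _ _ h1) (h4 hy)))
  refine contractibleSpace_fullSubcomplex_Iic hK hle hconv y e (fun x hx => (he x hx).2.1)
    (fun x hx => (he x hx).1) (fun x z hxz hz => (he x ((hle _ _ hxz).trans hz)).2.2.1 z hxz hz)
    (fun x x' hxx' hx' => ?_) (rk y + 1) fun x hx => ?_
  · have h := he x (hxx'.trans hx')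
    obtain ⟨z, hz, hcz, hzy⟩ := hpush x x' y (e x) hxx' hx' h.1 h.2.1
    exact hcz.trans ((he x' hx').2.2.1 z hz hzy)
  · have h := hiter x hx (rk y + 1)
    refine h.2.resolve_right fun h' => ?_
    have := hrk.monotone h.1
    omega

end Directed

end

section

open Set

namespace SimpleGraph

variable {V : Type*} {𝒯 : SimpleGraph V}

/-! ### Half-trees and convexity in a tree. -/

section Tree

theorem Connected.exists_adj_dist_add_one (hc : 𝒯.Connected) {r a : V} (h : a ≠ r) :
    ∃ u, 𝒯.Adj a u ∧ 𝒯.dist r u + 1 = 𝒯.dist r a := by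
  obtain ⟨p, hp⟩ := hc.exists_walk_length_eq_dist a r
  cases p with
  | nil => exact absurd rfl h
  | @cons _ u _ hau q =>
    refine ⟨u, hau, ?_⟩
    rw [Walk.length_cons] at hp
    have h1 := dist_le q
    have h2 := hc.dist_triangle (u := a) (v := u) (w := r)
    rw [dist_eq_one_iff_adj.2 hau] at h2
    rw [dist_comm (u := r) (v := u), dist_comm (u := r) (v := a)]
    omega

/-- Both neighbours are the penultimate vertex of the unique path from `r` to `a`. -/
theorem IsTree.eq_of_dist_lt (hT : 𝒯.IsTree) {r a u u' : V} (hu : 𝒯.Adj a u) (hu' : 𝒯.Adj a u')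
    (h : 𝒯.dist r u < 𝒯.dist r a) (h' : 𝒯.dist r u' < 𝒯.dist r a) : u = u' := by
  obtain ⟨p, hp⟩ := hT.connected.exists_walk_length_eq_dist r u
  obtain ⟨q, hq⟩ := hT.connected.exists_walk_length_eq_dist r u'
  have h1 := hT.dist_eq_dist_add_one_of_adj r hu
  have h2 := hT.dist_eq_dist_add_one_of_adj r hu'
  have hp' : (p.concat hu.symm).IsPath :=
    Walk.isPath_of_length_eq_dist _ (by rw [Walk.length_concat]; omega)
  have hq' : (q.concat hu'.symm).IsPath :=
    Walk.isPath_of_length_eq_dist _ (by rw [Walk.length_concat]; omega)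
  have := (hT.existsUnique_path r a).unique hp' hq'
  rw [← Walk.penultimate_concat p hu.symm, this, Walk.penultimate_concat]

variable (𝒯) in
/-- The vertices on the side of `v` of the edge `{v, w}`. -/
def halfTree (v w : V) : Set V := {u | 𝒯.dist u v < 𝒯.dist u w}

theorem mem_halfTree {u v w : V} : u ∈ 𝒯.halfTree v w ↔ 𝒯.dist u v < 𝒯.dist u w := Iff.rfl

theorem notMem_halfTree_symm {u v w : V} (h : u ∈ 𝒯.halfTree v w) : u ∉ 𝒯.halfTree w v :=
  fun h' => lt_asymm (mem_halfTree.1 h) (mem_halfTree.1 h')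

theorem IsTree.mem_halfTree_or (hT : 𝒯.IsTree) {v w : V} (h : 𝒯.Adj v w) (u : V) :
    u ∈ 𝒯.halfTree v w ∨ u ∈ 𝒯.halfTree w v := by
  rw [mem_halfTree, mem_halfTree]
  have := hT.dist_eq_dist_add_one_of_adj u h
  omega

theorem self_mem_halfTree {v w : V} (h : 𝒯.Adj v w) : v ∈ 𝒯.halfTree v w := by
  rw [mem_halfTree, dist_self, dist_eq_one_iff_adj.2 h]
  exact zero_lt_one

/-- The only edge between the two sides of `{v, w}` is `{v, w}` itself. -/
theorem IsTree.eq_of_adj_of_mem_halfTree (hT : 𝒯.IsTree) {u u' v w : V} (h : 𝒯.Adj v w)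
    (hu : u ∈ 𝒯.halfTree v w) (hu' : u' ∈ 𝒯.halfTree w v) (hadj : 𝒯.Adj u u') :
    u = v ∧ u' = w := by
  rw [mem_halfTree] at hu hu'
  have h1 := hT.dist_eq_dist_add_one_of_adj u h
  have h2 := hT.dist_eq_dist_add_one_of_adj u' h
  have h3 := hT.dist_eq_dist_add_one_of_adj v hadj
  have h4 := hT.dist_eq_dist_add_one_of_adj w hadj
  simp only [dist_comm (u := v), dist_comm (u := w)] at h3 h4
  -- Otherwise let `x` be the next vertex from `u` towards `v`. Both `x` and `u'` are nearer to `w`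
  -- than `u`, so they coincide; but `x` is nearer to `v` than `u`, while `u'` is farther.
  have huv : u = v := by
    by_contra hne
    obtain ⟨x, hux, hx⟩ := hT.connected.exists_adj_dist_add_one (r := v) hne
    have h5 := hT.dist_eq_dist_add_one_of_adj w hux
    have h6 := hT.connected.dist_triangle (u := x) (v := v) (w := w)
    rw [dist_eq_one_iff_adj.2 h] at h6
    simp only [dist_comm (u := v), dist_comm (u := w)] at hx h5
    have : u' = x := hT.eq_of_dist_lt (r := w) hadj hux
      (by rw [dist_comm, dist_comm (u := w)]; omega)
      (by rw [dist_comm, dist_comm (u := w)]; omega)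
    rw [this] at h3 h2 hu'
    omega
  refine ⟨huv, ?_⟩
  rw [huv, dist_self] at h3 h1
  rw [huv] at h4
  exact (hT.connected.dist_eq_zero_iff).1 (by omega)

/-- The vertices that are not strictly behind `v` as seen from `w`. -/
def cutBranch (𝒯 : SimpleGraph V) (v w : V) : Set V := {u | u ∈ 𝒯.halfTree v w → u = v}

/-- Geodesic convexity of a set of vertices of a tree. -/
def GeodConvex (𝒯 : SimpleGraph V) (A : Set V) : Prop :=
  ∀ r ∈ A, ∀ a ∈ A, ∀ u, 𝒯.Adj a u → 𝒯.dist r u < 𝒯.dist r a → u ∈ A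

theorem IsTree.geodConvex_cutBranch (hT : 𝒯.IsTree) {v w : V} (h : 𝒯.Adj v w) :
    𝒯.GeodConvex (𝒯.cutBranch v w) := by
  intro r hr a ha u hau hlt huH
  by_contra huv
  rcases hT.mem_halfTree_or h a with haH | haH
  · obtain rfl := ha haH
    rcases hT.mem_halfTree_or h r with hrH | hrH
    · obtain rfl := hr hrH
      rw [dist_self] at hlt
      exact Nat.not_lt_zero _ hlt
    · obtain rfl := hT.eq_of_dist_lt hau h hlt hrH
      exact notMem_halfTree_symm huH (self_mem_halfTree h.symm)
  · exact huv (hT.eq_of_adj_of_mem_halfTree h huH haH hau.symm).1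

theorem GeodConvex.inter {A A' : Set V} (h : 𝒯.GeodConvex A) (h' : 𝒯.GeodConvex A') :
    𝒯.GeodConvex (A ∩ A') := fun r hr a ha u hau hlt =>
  ⟨h r hr.1 a ha.1 u hau hlt, h' r hr.2 a ha.2 u hau hlt⟩

theorem GeodConvex.sInter {S : Set (Set V)} (h : ∀ A ∈ S, 𝒯.GeodConvex A) :
    𝒯.GeodConvex (⋂₀ S) := fun r hr a ha u hau hlt A hA =>
  h A hA r (hr A hA) a (ha A hA) u hau hlt

theorem GeodConvex.exists_adj (hc : 𝒯.Connected) {A : Set V} (hA : 𝒯.GeodConvex A) {r a : V}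
    (hr : r ∈ A) (ha : a ∈ A) (h : a ≠ r) :
    ∃ u ∈ A, 𝒯.Adj a u ∧ 𝒯.dist r u < 𝒯.dist r a := by
  obtain ⟨u, hau, hu⟩ := hc.exists_adj_dist_add_one h
  exact ⟨u, hA r hr a ha u hau (by omega), hau, by omega⟩

/-- In a connected subgraph of a tree, an edge of the tree separating two vertices is present. -/
theorem IsTree.subgraph_adj (hT : 𝒯.IsTree) {H : 𝒯.Subgraph} (hH : H.Connected) {a b v w : V}
    (ha : a ∈ H.verts) (hb : b ∈ H.verts) (h : 𝒯.Adj v w) (hav : a ∈ 𝒯.halfTree v w)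
    (hbw : b ∈ 𝒯.halfTree w v) : H.Adj v w := by
  obtain ⟨p, hp⟩ := (H.connected_iff_forall_exists_walk_subgraph.1 hH).2 ha hb
  obtain ⟨d, hd, h1, h2⟩ := p.exists_boundary_dart (𝒯.halfTree v w) hav
    (notMem_halfTree_symm hbw)
  have hdH : H.Adj d.fst d.snd := hp.2 (by
    rw [Walk.adj_toSubgraph_iff_mem_edges]
    exact List.mem_map_of_mem hd)
  obtain ⟨h3, h4⟩ := hT.eq_of_adj_of_mem_halfTree h h1
    ((hT.mem_halfTree_or h _).resolve_left h2) d.adj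
  rwa [h3, h4] at hdH

theorem IsTree.geodConvex_verts (hT : 𝒯.IsTree) {H : 𝒯.Subgraph} (hH : H.Connected) :
    𝒯.GeodConvex H.verts := fun _ hr _ ha _ hau hlt =>
  H.edge_vert (hT.subgraph_adj hH ha hr hau (self_mem_halfTree hau) hlt).symm

theorem IsTree.subgraph_adj_of_mem (hT : 𝒯.IsTree) {H : 𝒯.Subgraph} (hH : H.Connected) {a b : V}
    (ha : a ∈ H.verts) (hb : b ∈ H.verts) (h : 𝒯.Adj a b) : H.Adj a b :=
  hT.subgraph_adj hH ha hb h (self_mem_halfTree h) (self_mem_halfTree h.symm)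

theorem IsTree.subgraph_le_iff (hT : 𝒯.IsTree) {H H' : 𝒯.Subgraph} (hH' : H'.Connected) :
    H ≤ H' ↔ H.verts ⊆ H'.verts :=
  ⟨fun h => h.1, fun h => ⟨h, fun _ _ hab => hT.subgraph_adj_of_mem hH' (h (H.edge_vert hab))
    (h (H.edge_vert hab.symm)) hab.adj_sub⟩⟩

theorem GeodConvex.connected_induce (hc : 𝒯.Connected) {A : Set V} (hA : 𝒯.GeodConvex A)
    (hne : A.Nonempty) : ((⊤ : 𝒯.Subgraph).induce A).Connected := by
  obtain ⟨r, hr⟩ := hne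
  rw [Subgraph.connected_iff', connected_iff_exists_forall_reachable]
  refine ⟨⟨r, hr⟩, ?_⟩
  have : ∀ n a (ha : a ∈ A), 𝒯.dist r a = n →
      ((⊤ : 𝒯.Subgraph).induce A).coe.Reachable ⟨r, hr⟩ ⟨a, ha⟩ := by
    intro n
    induction n with
    | zero =>
      intro a ha h
      obtain rfl := hc.dist_eq_zero_iff.1 h
      exact Reachable.refl _
    | succ n ih =>
      intro a ha h
      have hne : a ≠ r := by
        rintro rfl
        simp at h
      obtain ⟨u, hau, hu⟩ := hc.exists_adj_dist_add_one hne
      have huA := hA r hr a ha u hau (by omega)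
      refine (ih u huA (by omega)).trans (Adj.reachable ?_)
      exact ⟨huA, ha, hau.symm⟩
  exact fun a => this _ a.1 a.2 rfl

/-- Without leaves one can always step further away from `w`, so the half-tree contains vertices at
every positive distance from `w`. -/
theorem IsTree.infinite_halfTree (hT : 𝒯.IsTree) (hNoLeaf : ∀ v, ¬ ∃! w, 𝒯.Adj v w) {v w : V}
    (h : 𝒯.Adj v w) : (𝒯.halfTree v w).Infinite := by
  have key : ∀ n, ∃ u ∈ 𝒯.halfTree v w, 𝒯.dist w u = n + 1 := by
    intro n
    induction n with
    | zero => exact ⟨v, self_mem_halfTree h, dist_eq_one_iff_adj.2 h.symm⟩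
    | succ n ih =>
      obtain ⟨u, hu, hun⟩ := ih
      have huw : u ≠ w := by
        rintro rfl
        simp at hun
      obtain ⟨x, hux, hx⟩ := hT.connected.exists_adj_dist_add_one (r := w) huw
      obtain ⟨y, huy, hyx⟩ : ∃ y, 𝒯.Adj u y ∧ y ≠ x := by
        by_contra! hcon
        exact hNoLeaf u ⟨x, hux, hcon⟩
      have hy := hT.dist_eq_dist_add_one_of_adj w huy
      have hyd : 𝒯.dist w y = n + 1 + 1 := by
        rcases hy with hy | hy
        · exact absurd (hT.eq_of_dist_lt (r := w) huy hux (by omega) (by omega)) hyx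
        · omega
      refine ⟨y, (hT.mem_halfTree_or h y).resolve_right fun hyH => ?_, hyd⟩
      obtain ⟨-, rfl⟩ := hT.eq_of_adj_of_mem_halfTree h hu hyH huy
      simp at hyd
  intro hfin
  obtain ⟨N, hN⟩ := (hfin.image (𝒯.dist w)).bddAbove
  obtain ⟨u, hu, hun⟩ := key N
  have := hN ⟨u, hu, rfl⟩
  omega

theorem IsTree.componentComplMk_eq_of_mem_halfTree (hT : 𝒯.IsTree) {v w : V} (h : 𝒯.Adj v w)
    {F : Set V} (hF : ∀ u ∈ 𝒯.halfTree v w, u ∉ F) {u : V} (hu : u ∈ 𝒯.halfTree v w) :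
    𝒯.componentComplMk (hF u hu) = 𝒯.componentComplMk (hF v (self_mem_halfTree h)) := by
  have : ∀ n u (hu : u ∈ 𝒯.halfTree v w), 𝒯.dist v u = n →
      𝒯.componentComplMk (hF u hu) = 𝒯.componentComplMk (hF v (self_mem_halfTree h)) := by
    intro n
    induction n with
    | zero =>
      intro u hu h0
      obtain rfl := hT.connected.dist_eq_zero_iff.1 h0
      rfl
    | succ n ih =>
      intro u hu hn
      have hne : u ≠ v := by
        rintro rfl
        simp at hn
      obtain ⟨x, hux, hx⟩ := hT.connected.exists_adj_dist_add_one (r := v) hne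
      have hxH : x ∈ 𝒯.halfTree v w := (hT.mem_halfTree_or h x).resolve_right fun hxH =>
        hne (hT.eq_of_adj_of_mem_halfTree h hu hxH hux).1
      rw [← ih x hxH (by omega)]
      exact componentComplMk_eq_of_adj _ _ _ hux
  exact this _ u hu rfl

end Tree

/-! ### Automorphisms preserve distances and half-trees. -/

section Action

variable {G : Type*} [Group G] [MulAction G V]

theorem dist_smul (hAct : ∀ (g : G) (v w : V), 𝒯.Adj v w → 𝒯.Adj (g • v) (g • w))
    (hc : 𝒯.Connected) (g : G) (v w : V) : 𝒯.dist (g • v) (g • w) = 𝒯.dist v w := by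
  have key : ∀ (g : G) (v w : V), 𝒯.dist (g • v) (g • w) ≤ 𝒯.dist v w := by
    intro g v w
    obtain ⟨p, hp⟩ := hc.exists_walk_length_eq_dist v w
    let φ : 𝒯 →g 𝒯 := ⟨fun v => g • v, fun h => hAct g _ _ h⟩
    rw [← hp, ← Walk.length_map φ p]
    exact dist_le _
  refine le_antisymm (key g v w) ?_
  have := key g⁻¹ (g • v) (g • w)
  rwa [inv_smul_smul, inv_smul_smul] at this

theorem smul_mem_halfTree (hAct : ∀ (g : G) (v w : V), 𝒯.Adj v w → 𝒯.Adj (g • v) (g • w))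
    (hc : 𝒯.Connected) (g : G) {u v w : V} :
    g • u ∈ 𝒯.halfTree (g • v) (g • w) ↔ u ∈ 𝒯.halfTree v w := by
  rw [mem_halfTree, mem_halfTree, dist_smul hAct hc, dist_smul hAct hc]

end Action

end SimpleGraph

end

section

open Set

namespace RigidPerm

open SimpleGraph

/-! ### Vertex sets of admissible trees, their intersections and hulls. -/

section AdmissibleSets

variable {V : Type*} {𝒯 : SimpleGraph V} {γ : V → V → Prop}

/-- The vertices of `A` all of whose neighbours lie in `A`. -/
def fullVerts (𝒯 : SimpleGraph V) (A : Set V) : Set V := {v | v ∈ A ∧ ∀ w, 𝒯.Adj v w → w ∈ A}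

/-- `v` is a leaf of the subtree spanned by `A`, with neighbour `w`. -/
def LeafDart (𝒯 : SimpleGraph V) (A : Set V) (v w : V) : Prop :=
  v ∈ A ∧ w ∈ A ∧ 𝒯.Adj v w ∧ ∀ w' ∈ A, 𝒯.Adj v w' → w' = w

/-- The vertex sets of admissible trees, for the gates described by `γ`. -/
structure IsAdmSet (𝒯 : SimpleGraph V) (γ : V → V → Prop) (A : Set V) : Prop where
  finite : A.Finite
  nonempty : A.Nonempty
  convex : 𝒯.GeodConvex A
  full_or_leaf : ∀ v ∈ A, v ∈ fullVerts 𝒯 A ∨ ∃ w, LeafDart 𝒯 A v w ∧ γ v w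

theorem fullVerts_subset (A : Set V) : fullVerts 𝒯 A ⊆ A := fun _ h => h.1

theorem fullVerts_mono {A A' : Set V} (h : A ⊆ A') : fullVerts 𝒯 A ⊆ fullVerts 𝒯 A' :=
  fun _ hv => ⟨h hv.1, fun w hw => h (hv.2 w hw)⟩

theorem LeafDart.notMem_fullVerts (hNoLeaf : ∀ v, ¬ ∃! w, 𝒯.Adj v w) {A : Set V} {v w : V}
    (h : LeafDart 𝒯 A v w) : v ∉ fullVerts 𝒯 A := fun hv =>
  hNoLeaf v ⟨w, h.2.2.1, fun w' hw' => h.2.2.2 w' (hv.2 w' hw') hw'⟩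

/-- A vertex of `A` strictly behind the leaf `v` would, by convexity, put into `A` a second
neighbour of `v`. -/
theorem LeafDart.subset_cutBranch (hT : 𝒯.IsTree) {A : Set V} (hA : 𝒯.GeodConvex A) {v w : V}
    (h : LeafDart 𝒯 A v w) : A ⊆ 𝒯.cutBranch v w := by
  intro a ha haH
  by_contra hne
  obtain ⟨u, hu, hvu, hlt⟩ := hA.exists_adj hT.connected ha h.1 (Ne.symm hne)
  rw [h.2.2.2 u hu hvu] at hlt
  exact lt_asymm hlt haH

theorem exists_adj_of_isTree [Nontrivial V] (hT : 𝒯.IsTree) (v : V) : ∃ w, 𝒯.Adj v w := by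
  obtain ⟨r, hr⟩ := exists_ne v
  obtain ⟨w, hw, -⟩ := hT.connected.exists_adj_dist_add_one hr.symm
  exact ⟨w, hw⟩

namespace IsAdmSet

theorem exists_adj_mem [Nontrivial V] (hT : 𝒯.IsTree) {A : Set V} (hA : IsAdmSet 𝒯 γ A) {v : V}
    (hv : v ∈ A) : ∃ w ∈ A, 𝒯.Adj v w := by
  rcases hA.full_or_leaf v hv with h | ⟨w, h, -⟩
  · obtain ⟨w, hw⟩ := exists_adj_of_isTree hT v
    exact ⟨w, h.2 w hw, hw⟩
  · exact ⟨w, h.2.1, h.2.2.1⟩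

theorem exists_leafDart_of_notMem_fullVerts {A : Set V} (hA : IsAdmSet 𝒯 γ A) {v : V}
    (hv : v ∈ A) (hf : v ∉ fullVerts 𝒯 A) : ∃ w, LeafDart 𝒯 A v w ∧ γ v w :=
  (hA.full_or_leaf v hv).resolve_left hf

/-- A common vertex that is not full in some `A` is a leaf of `A`. Two distinct common vertices are
required so that, by convexity, its only neighbour in `A` survives in the intersection; the gate
condition is then inherited. -/
theorem sInter (hT : 𝒯.IsTree) {S : Set (Set V)} (hS : S.Nonempty) (h : ∀ A ∈ S, IsAdmSet 𝒯 γ A)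
    {x y : V} (hx : ∀ A ∈ S, x ∈ A) (hy : ∀ A ∈ S, y ∈ A) (hxy : x ≠ y) :
    IsAdmSet 𝒯 γ (⋂₀ S) := by
  have hconv : 𝒯.GeodConvex (⋂₀ S) := .sInter fun A hA => (h A hA).convex
  obtain ⟨A₀, hA₀⟩ := hS
  refine ⟨(h A₀ hA₀).finite.subset (sInter_subset_of_mem hA₀), ⟨x, hx⟩, hconv, fun v hv => ?_⟩
  by_cases hfull : ∀ A ∈ S, v ∈ fullVerts 𝒯 A
  · exact Or.inl ⟨hv, fun w hw A hA => (hfull A hA).2 w hw⟩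
  · push Not at hfull
    obtain ⟨A, hA, hvA⟩ := hfull
    obtain ⟨w, hw, hγ⟩ := (h A hA).exists_leafDart_of_notMem_fullVerts (hv A hA) hvA
    obtain ⟨r, hr, hvr⟩ : ∃ r ∈ ⋂₀ S, v ≠ r := by
      by_cases hvx : v = x
      · exact ⟨y, hy, hvx ▸ hxy⟩
      · exact ⟨x, hx, hvx⟩
    obtain ⟨u, hu, hvu, -⟩ := hconv.exists_adj hT.connected hr hv hvr
    obtain rfl := hw.2.2.2 u (hu A hA) hvu
    exact Or.inr ⟨u, ⟨hv, hu, hvu, fun w' hw' => hw.2.2.2 w' (hw' A hA)⟩, hγ⟩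

theorem inter (hT : 𝒯.IsTree) {A A' : Set V} (hA : IsAdmSet 𝒯 γ A) (hA' : IsAdmSet 𝒯 γ A')
    {x y : V} (hx : x ∈ A ∩ A') (hy : y ∈ A ∩ A') (hxy : x ≠ y) : IsAdmSet 𝒯 γ (A ∩ A') := by
  rw [← sInter_pair]
  refine sInter hT ⟨A, mem_insert _ _⟩ ?_ (x := x) (y := y) ?_ ?_ hxy
  · rintro _ (rfl | rfl)
    exacts [hA, hA']
  · rintro _ (rfl | rfl)
    exacts [hx.1, hx.2]
  · rintro _ (rfl | rfl)
    exacts [hy.1, hy.2]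

/-- The vertex of `A` nearest to `u` has a neighbour outside `A`, so it is a leaf, and `u` lies
behind it. -/
theorem exists_leafDart_of_notMem (hT : 𝒯.IsTree) {A : Set V} (hA : IsAdmSet 𝒯 γ A) {u : V}
    (hu : u ∉ A) : ∃ v w, LeafDart 𝒯 A v w ∧ u ∈ 𝒯.halfTree v w := by
  obtain ⟨v, hv, hmin⟩ := hA.finite.exists_minimalFor (𝒯.dist u) A hA.nonempty
  have hvu : v ≠ u := fun h => hu (h ▸ hv)
  obtain ⟨t, hvt, ht⟩ := hT.connected.exists_adj_dist_add_one hvu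
  have htA : t ∉ A := fun h => by
    have := hmin h (by omega)
    omega
  obtain ⟨w, hw, -⟩ := hA.exists_leafDart_of_notMem_fullVerts hv fun h => htA (h.2 t hvt)
  refine ⟨v, w, hw, (hT.mem_halfTree_or hw.2.2.1 u).resolve_right fun h => ?_⟩
  rw [mem_halfTree] at h
  exact htA (hT.eq_of_dist_lt (r := u) hvt hw.2.2.1 (by omega) h ▸ hw.2.1)

theorem exists_leafDart_of_notMem_full (hT : 𝒯.IsTree) {A : Set V} (hA : IsAdmSet 𝒯 γ A) {u : V}
    (hu : u ∉ fullVerts 𝒯 A) : ∃ v w, LeafDart 𝒯 A v w ∧ u ∈ 𝒯.halfTree v w := by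
  by_cases huA : u ∈ A
  · obtain ⟨w, hw, -⟩ := hA.exists_leafDart_of_notMem_fullVerts huA hu
    exact ⟨u, w, hw, self_mem_halfTree hw.2.2.1⟩
  · exact hA.exists_leafDart_of_notMem hT huA

/-- Cutting an admissible set at a leaf of a smaller one. -/
theorem inter_cutBranch (hT : 𝒯.IsTree) {S E : Set V} (hS : IsAdmSet 𝒯 γ S)
    (hE : IsAdmSet 𝒯 γ E) (hSE : S ⊆ E) {s w : V} (hs : LeafDart 𝒯 S s w) (hγ : γ s w) :
    IsAdmSet 𝒯 γ (E ∩ 𝒯.cutBranch s w) := by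
  have hsub := hs.subset_cutBranch hT hS.convex
  refine ⟨hE.finite.subset inter_subset_left, ⟨s, hSE hs.1, hsub hs.1⟩,
    hE.convex.inter (hT.geodConvex_cutBranch hs.2.2.1), fun v hv => ?_⟩
  have hws : ∀ {u u' : V}, u ∈ 𝒯.halfTree s w → u' ∈ 𝒯.halfTree w s → 𝒯.Adj u u' →
      u = s ∧ u' = w := hT.eq_of_adj_of_mem_halfTree hs.2.2.1
  by_cases hvs : v = s
  · subst hvs
    refine Or.inr ⟨w, ⟨hv, ⟨hSE hs.2.1, hsub hs.2.1⟩, hs.2.2.1, fun u hu hvu => ?_⟩, hγ⟩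
    rcases hT.mem_halfTree_or hs.2.2.1 u with h | h
    · exact absurd (hu.2 h) hvu.ne'
    · exact (hws (self_mem_halfTree hs.2.2.1) h hvu).2
  · have hvw : v ∈ 𝒯.halfTree w s :=
      (hT.mem_halfTree_or hs.2.2.1 v).resolve_left fun h => hvs (hv.2 h)
    have hnb : ∀ u, 𝒯.Adj v u → u ∈ 𝒯.cutBranch s w := fun u hvu huH => (hws huH hvw hvu.symm).1
    rcases hE.full_or_leaf v hv.1 with h | ⟨x, hx, hγx⟩
    · exact Or.inl ⟨hv, fun u hu => ⟨h.2 u hu, hnb u hu⟩⟩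
    · exact Or.inr ⟨x, ⟨hv, ⟨hx.2.1, hnb x hx.2.2.1⟩, hx.2.2.1, fun u hu => hx.2.2.2 u hu.1⟩, hγx⟩

end IsAdmSet

/-- The smallest admissible set in which all the vertices of `T` are interior. -/
def fullHull (𝒯 : SimpleGraph V) (γ : V → V → Prop) (T : Set V) : Set V :=
  ⋂₀ {U | IsAdmSet 𝒯 γ U ∧ T ⊆ fullVerts 𝒯 U}

theorem fullHull_subset {T U : Set V} (hU : IsAdmSet 𝒯 γ U) (h : T ⊆ fullVerts 𝒯 U) :
    fullHull 𝒯 γ T ⊆ U := sInter_subset_of_mem ⟨hU, h⟩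

theorem fullHull_mono {T T' : Set V} (h : T ⊆ T') : fullHull 𝒯 γ T ⊆ fullHull 𝒯 γ T' :=
  sInter_subset_sInter fun _ hU => ⟨hU.1, h.trans hU.2⟩

theorem subset_fullVerts_fullHull (T : Set V) : T ⊆ fullVerts 𝒯 (fullHull 𝒯 γ T) :=
  fun _ hv => ⟨fun _ hU => (hU.2 hv).1, fun w hw _ hU => (hU.2 hv).2 w hw⟩

theorem subset_fullHull (T : Set V) : T ⊆ fullHull 𝒯 γ T :=
  (subset_fullVerts_fullHull T).trans (fullVerts_subset _)

theorem isAdmSet_fullHull [Nontrivial V] (hT : 𝒯.IsTree)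
    (hγ : ∀ X : Set V, X.Finite → ∃ U, IsAdmSet 𝒯 γ U ∧ X ⊆ fullVerts 𝒯 U) {T : Set V}
    (hfin : T.Finite) (hne : T.Nonempty) : IsAdmSet 𝒯 γ (fullHull 𝒯 γ T) := by
  obtain ⟨v, hv⟩ := hne
  obtain ⟨w, hw⟩ := exists_adj_of_isTree hT v
  exact .sInter hT (hγ T hfin) (fun U hU => hU.1) (fun U hU => (hU.2 hv).1)
    (fun U hU => (hU.2 hv).2 w hw) hw.ne

/-- A leaf of `S ⊇ T` that does not belong to `T` is a leaf of `fullHull T`. -/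
theorem notMem_fullVerts_fullHull (hT : 𝒯.IsTree) (hNoLeaf : ∀ v, ¬ ∃! w, 𝒯.Adj v w)
    {T S : Set V} (hE : IsAdmSet 𝒯 γ (fullHull 𝒯 γ T)) (hS : IsAdmSet 𝒯 γ S) (hTS : T ⊆ S)
    (hSE : S ⊆ fullHull 𝒯 γ T) {s : V} (hs : s ∈ S) (hsT : s ∉ T) (hsf : s ∉ fullVerts 𝒯 S) :
    s ∉ fullVerts 𝒯 (fullHull 𝒯 γ T) := by
  obtain ⟨w, hw, hγ⟩ := hS.exists_leafDart_of_notMem_fullVerts hs hsf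
  -- Cutting the hull at `s` leaves an admissible set, which still has `T` in its interior because
  -- `s ∉ T`. By minimality the hull does not go beyond `s`.
  have hE' := hS.inter_cutBranch hT hE hSE hw hγ
  have hsub := hw.subset_cutBranch hT hS.convex
  have hTE' : T ⊆ fullVerts 𝒯 (fullHull 𝒯 γ T ∩ 𝒯.cutBranch s w) := by
    intro v hv
    refine ⟨⟨subset_fullHull T hv, hsub (hTS hv)⟩, fun u hu =>
      ⟨(subset_fullVerts_fullHull T hv).2 u hu, fun huH => ?_⟩⟩
    have hvw : v ∈ 𝒯.halfTree w s := (hT.mem_halfTree_or hw.2.2.1 v).resolve_left fun h =>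
      hsT (hsub (hTS hv) h ▸ hv)
    exact (hT.eq_of_adj_of_mem_halfTree hw.2.2.1 huH hvw hu.symm).1
  intro hfull
  refine hNoLeaf s ⟨w, hw.2.2.1, fun u hu => ?_⟩
  have hu' := (fullHull_subset hE' hTE' (hfull.2 u hu)).2
  rcases hT.mem_halfTree_or hw.2.2.1 u with h | h
  · exact absurd (hu' h) hu.ne'
  · exact (hT.eq_of_adj_of_mem_halfTree hw.2.2.1 (self_mem_halfTree hw.2.2.1) h hu).2

end AdmissibleSets

/-! ### Permutations acting by group elements on the branches off a tree. -/

section BranchSupport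

variable {G V : Type*} [Group G] [MulAction G V] {𝒯 : SimpleGraph V} {γ : V → V → Prop}

theorem IsRigidSupport.mono {φ : Equiv.Perm V} {F F' : Set V} (h : F ⊆ F')
    (hF : IsRigidSupport G 𝒯 φ F) : IsRigidSupport G 𝒯 φ F' := by
  intro C hC
  have hsub : C.supp ⊆ (C.hom h).supp := ComponentCompl.subset_hom C h
  obtain ⟨g, hg⟩ := hF (C.hom h) (hC.mono hsub)
  exact ⟨g, fun v hv => hg v (hsub hv)⟩

variable (G 𝒯) in
/-- `φ` acts by an element of `G` on each branch of the tree spanned by `T`, and globally if that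
tree is a single edge. -/
def BranchSupport (φ : Equiv.Perm V) (T : Set V) : Prop :=
  (∀ v w, LeafDart 𝒯 T v w → ∃ g : G, ∀ u ∈ 𝒯.halfTree v w, φ u = g • u) ∧
    (fullVerts 𝒯 T = ∅ → ∃ g : G, ∀ u, φ u = g • u)

/-- Removing the interior leaves the half-trees at the leaves as components, all infinite since
there are no leaves in `𝒯`. The exception is a single edge: its interior is empty and the two
half-trees merge into one component. -/
theorem isRigidSupport_fullVerts_iff (hT : 𝒯.IsTree) (hNoLeaf : ∀ v, ¬ ∃! w, 𝒯.Adj v w)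
    {φ : Equiv.Perm V} {T : Set V} (hA : IsAdmSet 𝒯 γ T) :
    IsRigidSupport G 𝒯 φ (fullVerts 𝒯 T) ↔ BranchSupport G 𝒯 φ T := by
  have hdisj : ∀ v w, LeafDart 𝒯 T v w → ∀ u ∈ 𝒯.halfTree v w, u ∉ fullVerts 𝒯 T := by
    intro v w h u hu huf
    obtain rfl := h.subset_cutBranch hT hA.convex huf.1 hu
    exact h.notMem_fullVerts hNoLeaf huf
  constructor
  · intro h
    refine ⟨fun v w hvw => ?_, fun hempty => ?_⟩
    · have hF := hdisj v w hvw
      let C := 𝒯.componentComplMk (hF v (self_mem_halfTree hvw.2.2.1))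
      have hsub : 𝒯.halfTree v w ⊆ C.supp := fun u hu =>
        ⟨hF u hu, hT.componentComplMk_eq_of_mem_halfTree hvw.2.2.1 hF hu⟩
      obtain ⟨g, hg⟩ := h C ((hT.infinite_halfTree hNoLeaf hvw.2.2.1).mono hsub)
      exact ⟨g, fun u hu => hg u (hsub hu)⟩
    · obtain ⟨v, hv⟩ := hA.nonempty
      have hF : ∀ u, u ∉ fullVerts 𝒯 T := fun u hu => by simp [hempty] at hu
      obtain ⟨w, hvw, -⟩ := hA.exists_leafDart_of_notMem_fullVerts hv (hF v)
      let C := 𝒯.componentComplMk (hF v)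
      have hC : 𝒯.componentComplMk (hF w) = C :=
        componentComplMk_eq_of_adj _ _ _ hvw.2.2.1.symm
      have hsub : ∀ u, u ∈ C.supp := by
        intro u
        refine ⟨hF u, ?_⟩
        rcases hT.mem_halfTree_or hvw.2.2.1 u with hu | hu
        · exact hT.componentComplMk_eq_of_mem_halfTree hvw.2.2.1 (fun u _ => hF u) hu
        · exact (hT.componentComplMk_eq_of_mem_halfTree hvw.2.2.1.symm (fun u _ => hF u) hu).trans
            hC
      obtain ⟨g, hg⟩ := h C ((hT.infinite_halfTree hNoLeaf hvw.2.2.1).mono fun u _ => hsub u)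
      exact ⟨g, fun u => hg u (hsub u)⟩
  · rintro ⟨h1, h2⟩ C hC
    rcases (fullVerts 𝒯 T).eq_empty_or_nonempty with hempty | ⟨z, hz⟩
    · exact (h2 hempty).imp fun g hg v _ => hg v
    · obtain ⟨u, huF, rfl⟩ := hC.nonempty
      obtain ⟨v, w, hvw, hu⟩ := hA.exists_leafDart_of_notMem_full hT huF
      obtain ⟨g, hg⟩ := h1 v w hvw
      refine ⟨g, fun c hc => hg c ?_⟩
      -- A path leaving the branch at `v` crosses to `w`, so `w` is not interior either. Then `v`
      -- and `w` are both leaves, and no room is left for the interior vertex `z`.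
      by_contra hcH
      obtain ⟨hcF, hc⟩ := hc
      obtain ⟨p⟩ := ConnectedComponent.exact hc.symm
      obtain ⟨d, -, hd1, hd2⟩ := p.exists_boundary_dart {x | x.1 ∈ 𝒯.halfTree v w} hu hcH
      obtain ⟨-, hdw⟩ := hT.eq_of_adj_of_mem_halfTree hvw.2.2.1 hd1
        ((hT.mem_halfTree_or hvw.2.2.1 _).resolve_left hd2) d.adj
      have hwF : w ∉ fullVerts 𝒯 T := hdw ▸ d.snd.2
      obtain ⟨x, hx, -⟩ := hA.exists_leafDart_of_notMem_fullVerts hvw.2.1 hwF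
      obtain rfl := hx.2.2.2 v hvw.1 hvw.2.2.1.symm
      rcases hT.mem_halfTree_or hvw.2.2.1 z with hzH | hzH
      · exact hvw.notMem_fullVerts hNoLeaf (hvw.subset_cutBranch hT hA.convex hz.1 hzH ▸ hz)
      · exact hwF (hx.subset_cutBranch hT hA.convex hz.1 hzH ▸ hz)

namespace BranchSupport

/-- The translated branch is already the image of the branch, so by injectivity the image of `T` can
meet it only at its root `g • v`. -/
theorem image_subset_cutBranch (hT : 𝒯.IsTree)
    (hAct : ∀ (g : G) (v w : V), 𝒯.Adj v w → 𝒯.Adj (g • v) (g • w))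
    {φ : Equiv.Perm V} {T : Set V} (hA : IsAdmSet 𝒯 γ T) {v w : V}
    (hvw : LeafDart 𝒯 T v w) {g : G} (hg : ∀ u ∈ 𝒯.halfTree v w, φ u = g • u) :
    φ '' T ⊆ 𝒯.cutBranch (g • v) (g • w) := by
  rintro _ ⟨t, ht, rfl⟩ hH
  rw [← smul_inv_smul g (φ t), smul_mem_halfTree hAct hT.connected] at hH
  have h1 : φ (g⁻¹ • φ t) = φ t := by rw [hg _ hH, smul_inv_smul]
  rw [φ.injective h1] at hH
  rw [hg t hH, hvw.subset_cutBranch hT hA.convex ht hH]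

/-- A vertex outside the image of `T` lies on the image of a branch. -/
theorem exists_of_notMem_image (hT : 𝒯.IsTree)
    (hAct : ∀ (g : G) (v w : V), 𝒯.Adj v w → 𝒯.Adj (g • v) (g • w))
    {φ : Equiv.Perm V} {T : Set V} (hA : IsAdmSet 𝒯 γ T) (hφ : BranchSupport G 𝒯 φ T) {u : V}
    (hu : u ∉ φ '' T) : ∃ v w, LeafDart 𝒯 T v w ∧ ∃ g : G, (∀ x ∈ 𝒯.halfTree v w, φ x = g • x) ∧
      u ∈ 𝒯.halfTree (g • v) (g • w) ∧ u ≠ g • v := by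
  have hu' : φ.symm u ∉ T := fun h => hu ⟨_, h, φ.apply_symm_apply u⟩
  obtain ⟨v, w, hvw, h⟩ := hA.exists_leafDart_of_notMem hT hu'
  obtain ⟨g, hg⟩ := hφ.1 v w hvw
  have hgu : u = g • φ.symm u := by rw [← hg _ h, φ.apply_symm_apply]
  refine ⟨v, w, hvw, g, hg, ?_, fun h' => ?_⟩
  · rw [hgu, smul_mem_halfTree hAct hT.connected]
    exact h
  · rw [hgu] at h'
    exact hu' (smul_left_cancel g h' ▸ hvw.1)

/-- A geodesic step leaving the image would enter a translated branch beyond its root, although the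
image lies in the convex complement of that part. -/
theorem geodConvex_image (hT : 𝒯.IsTree)
    (hAct : ∀ (g : G) (v w : V), 𝒯.Adj v w → 𝒯.Adj (g • v) (g • w))
    {φ : Equiv.Perm V} {T : Set V} (hA : IsAdmSet 𝒯 γ T) (hφ : BranchSupport G 𝒯 φ T) :
    𝒯.GeodConvex (φ '' T) := by
  intro r hr a ha u hau hlt
  by_contra hu
  obtain ⟨v, w, hvw, g, hg, huH, hne⟩ := exists_of_notMem_image hT hAct hA hφ hu
  have hsub := image_subset_cutBranch hT hAct hA hvw hg
  exact hne (hT.geodConvex_cutBranch (hAct g _ _ hvw.2.2.1) r (hsub hr) a (hsub ha) u hau hlt huH)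

theorem mem_fullVerts_image (hT : 𝒯.IsTree)
    (hAct : ∀ (g : G) (v w : V), 𝒯.Adj v w → 𝒯.Adj (g • v) (g • w))
    (hNoLeaf : ∀ v, ¬ ∃! w, 𝒯.Adj v w)
    {φ : Equiv.Perm V} {T : Set V} (hA : IsAdmSet 𝒯 γ T) (hφ : BranchSupport G 𝒯 φ T) {t : V}
    (ht : t ∈ fullVerts 𝒯 T) : φ t ∈ fullVerts 𝒯 (φ '' T) := by
  refine ⟨⟨t, ht.1, rfl⟩, fun u hu => ?_⟩
  by_contra hu'
  obtain ⟨v, w, hvw, g, hg, huH, hne⟩ := exists_of_notMem_image hT hAct hA hφ hu'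
  have hadj := hAct g _ _ hvw.2.2.1
  rcases hT.mem_halfTree_or hadj (φ t) with h | h
  · have h1 := image_subset_cutBranch hT hAct hA hvw hg ⟨t, ht.1, rfl⟩ h
    rw [← hg v (self_mem_halfTree hvw.2.2.1)] at h1
    exact hvw.notMem_fullVerts hNoLeaf (φ.injective h1 ▸ ht)
  · exact hne (hT.eq_of_adj_of_mem_halfTree hadj huH h hu.symm).1

/-- `φ w` need not be `g • w`. Convexity of the image provides some neighbour of `g • v` in it, and
every neighbour other than `g • w` lies in the translated branch, off the image. -/
theorem leafDart_image [Nontrivial V] (hT : 𝒯.IsTree)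
    (hAct : ∀ (g : G) (v w : V), 𝒯.Adj v w → 𝒯.Adj (g • v) (g • w))
    {φ : Equiv.Perm V} {T : Set V} (hA : IsAdmSet 𝒯 γ T) (hφ : BranchSupport G 𝒯 φ T) {v w : V}
    (hvw : LeafDart 𝒯 T v w) {g : G} (hg : ∀ u ∈ 𝒯.halfTree v w, φ u = g • u) :
    LeafDart 𝒯 (φ '' T) (g • v) (g • w) := by
  have hadj := hAct g _ _ hvw.2.2.1
  have hv : φ v = g • v := hg v (self_mem_halfTree hvw.2.2.1)
  have hvT : g • v ∈ φ '' T := ⟨v, hvw.1, hv⟩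
  have hnb : ∀ u ∈ φ '' T, 𝒯.Adj (g • v) u → u = g • w := by
    intro u hu hvu
    rcases hT.mem_halfTree_or hadj u with h | h
    · exact absurd (image_subset_cutBranch hT hAct hA hvw hg hu h) hvu.ne'
    · exact (hT.eq_of_adj_of_mem_halfTree hadj (self_mem_halfTree hadj) h hvu).2
  obtain ⟨u, hu, hvu, -⟩ := (geodConvex_image hT hAct hA hφ).exists_adj hT.connected
    (r := φ w) ⟨w, hvw.2.1, rfl⟩ hvT (fun h => hvw.2.2.1.ne (φ.injective (hv.trans h)))
  exact ⟨hvT, hnb u hu hvu ▸ hu, hadj, hnb⟩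

theorem fullVerts_image [Nontrivial V] (hT : 𝒯.IsTree)
    (hAct : ∀ (g : G) (v w : V), 𝒯.Adj v w → 𝒯.Adj (g • v) (g • w))
    (hNoLeaf : ∀ v, ¬ ∃! w, 𝒯.Adj v w)
    {φ : Equiv.Perm V} {T : Set V} (hA : IsAdmSet 𝒯 γ T) (hφ : BranchSupport G 𝒯 φ T) :
    fullVerts 𝒯 (φ '' T) = φ '' fullVerts 𝒯 T := by
  refine Subset.antisymm ?_ ?_
  · intro u hu
    obtain ⟨t, ht, rfl⟩ := hu.1
    refine ⟨t, ?_, rfl⟩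
    by_contra htf
    obtain ⟨w, hw, -⟩ := hA.exists_leafDart_of_notMem_fullVerts ht htf
    obtain ⟨g, hg⟩ := hφ.1 t w hw
    rw [hg t (self_mem_halfTree hw.2.2.1)] at hu
    exact (leafDart_image hT hAct hA hφ hw hg).notMem_fullVerts hNoLeaf hu
  · rintro _ ⟨t, ht, rfl⟩
    exact mem_fullVerts_image hT hAct hNoLeaf hA hφ ht

theorem isAdmSet_image [Nontrivial V] (hT : 𝒯.IsTree)
    (hAct : ∀ (g : G) (v w : V), 𝒯.Adj v w → 𝒯.Adj (g • v) (g • w))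
    (hNoLeaf : ∀ v, ¬ ∃! w, 𝒯.Adj v w) (hγ : ∀ (g : G) v w, γ v w → γ (g • v) (g • w))
    {φ : Equiv.Perm V} {T : Set V} (hA : IsAdmSet 𝒯 γ T) (hφ : BranchSupport G 𝒯 φ T) :
    IsAdmSet 𝒯 γ (φ '' T) := by
  refine ⟨hA.finite.image _, hA.nonempty.image _, geodConvex_image hT hAct hA hφ, ?_⟩
  rintro _ ⟨t, ht, rfl⟩
  by_cases htf : t ∈ fullVerts 𝒯 T
  · exact Or.inl (mem_fullVerts_image hT hAct hNoLeaf hA hφ htf)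
  · obtain ⟨w, hw, hγw⟩ := hA.exists_leafDart_of_notMem_fullVerts ht htf
    obtain ⟨g, hg⟩ := hφ.1 t w hw
    rw [hg t (self_mem_halfTree hw.2.2.1)]
    exact Or.inr ⟨g • w, leafDart_image hT hAct hA hφ hw hg, hγ g _ _ hγw⟩

theorem exists_leafDart_of_leafDart_image [Nontrivial V] (hT : 𝒯.IsTree)
    (hAct : ∀ (g : G) (v w : V), 𝒯.Adj v w → 𝒯.Adj (g • v) (g • w))
    (hNoLeaf : ∀ v, ¬ ∃! w, 𝒯.Adj v w)
    {φ : Equiv.Perm V} {T : Set V} (hA : IsAdmSet 𝒯 γ T) (hφ : BranchSupport G 𝒯 φ T) {v' w' : V}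
    (h : LeafDart 𝒯 (φ '' T) v' w') : ∃ v w, LeafDart 𝒯 T v w ∧ ∃ g : G,
      (∀ u ∈ 𝒯.halfTree v w, φ u = g • u) ∧ v' = g • v ∧ w' = g • w := by
  obtain ⟨t, ht, rfl⟩ := h.1
  have htf : t ∉ fullVerts 𝒯 T := fun htf =>
    h.notMem_fullVerts hNoLeaf (mem_fullVerts_image hT hAct hNoLeaf hA hφ htf)
  obtain ⟨w, hw, -⟩ := hA.exists_leafDart_of_notMem_fullVerts ht htf
  obtain ⟨g, hg⟩ := hφ.1 t w hw
  have ht' : φ t = g • t := hg t (self_mem_halfTree hw.2.2.1)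
  have hl := leafDart_image hT hAct hA hφ hw hg
  exact ⟨t, w, hw, g, hg, ht', (h.2.2.2 _ hl.2.1 (ht' ▸ hl.2.2.1)).symm⟩

theorem inv [Nontrivial V] (hT : 𝒯.IsTree)
    (hAct : ∀ (g : G) (v w : V), 𝒯.Adj v w → 𝒯.Adj (g • v) (g • w))
    (hNoLeaf : ∀ v, ¬ ∃! w, 𝒯.Adj v w)
    {φ : Equiv.Perm V} {T : Set V} (hA : IsAdmSet 𝒯 γ T) (hφ : BranchSupport G 𝒯 φ T) :
    BranchSupport G 𝒯 φ⁻¹ (φ '' T) := by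
  refine ⟨fun v' w' h => ?_, fun h => ?_⟩
  · obtain ⟨v, w, hw, g, hg, rfl, rfl⟩ := exists_leafDart_of_leafDart_image hT hAct hNoLeaf hA hφ h
    refine ⟨g⁻¹, fun u hu => ?_⟩
    rw [← smul_inv_smul g u, smul_mem_halfTree hAct hT.connected] at hu
    rw [Equiv.Perm.inv_eq_iff_eq, hg _ hu, smul_inv_smul]
  · rw [fullVerts_image hT hAct hNoLeaf hA hφ, image_eq_empty] at h
    obtain ⟨g, hg⟩ := hφ.2 h
    refine ⟨g⁻¹, fun u => ?_⟩
    rw [Equiv.Perm.inv_eq_iff_eq, hg, smul_inv_smul]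

theorem mul [Nontrivial V] (hT : 𝒯.IsTree)
    (hAct : ∀ (g : G) (v w : V), 𝒯.Adj v w → 𝒯.Adj (g • v) (g • w))
    (hNoLeaf : ∀ v, ¬ ∃! w, 𝒯.Adj v w)
    {φ ψ : Equiv.Perm V} {T : Set V} (hA : IsAdmSet 𝒯 γ T) (hφ : BranchSupport G 𝒯 φ T)
    (hψ : BranchSupport G 𝒯 ψ (φ '' T)) : BranchSupport G 𝒯 (ψ * φ) T := by
  refine ⟨fun v w hvw => ?_, fun h => ?_⟩
  · obtain ⟨g, hg⟩ := hφ.1 v w hvw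
    obtain ⟨g', hg'⟩ := hψ.1 _ _ (leafDart_image hT hAct hA hφ hvw hg)
    refine ⟨g' * g, fun u hu => ?_⟩
    rw [Equiv.Perm.mul_apply, hg u hu, hg' _ ((smul_mem_halfTree hAct hT.connected g).2 hu),
      mul_smul]
  · obtain ⟨g, hg⟩ := hφ.2 h
    obtain ⟨g', hg'⟩ := hψ.2 (by rw [fullVerts_image hT hAct hNoLeaf hA hφ, h, image_empty])
    exact ⟨g' * g, fun u => by rw [Equiv.Perm.mul_apply, hg, hg', mul_smul]⟩

/-- The image of the full hull is the full hull of the image. -/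
theorem image_fullHull_subset [Nontrivial V] (hT : 𝒯.IsTree)
    (hAct : ∀ (g : G) (v w : V), 𝒯.Adj v w → 𝒯.Adj (g • v) (g • w))
    (hNoLeaf : ∀ v, ¬ ∃! w, 𝒯.Adj v w) (hγ : ∀ (g : G) v w, γ v w → γ (g • v) (g • w))
    {φ : Equiv.Perm V} {T : Set V} (hA : IsAdmSet 𝒯 γ T) (hφ : BranchSupport G 𝒯 φ T) :
    φ '' fullHull 𝒯 γ T ⊆ fullHull 𝒯 γ (φ '' T) := by
  rintro _ ⟨u, hu, rfl⟩ U ⟨hU, hTU⟩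
  have hA' := isAdmSet_image hT hAct hNoLeaf hγ hA hφ
  have hφ' := inv hT hAct hNoLeaf hA hφ
  -- The interior of `U` contains the image of `T`, so `φ⁻¹` acts by group elements on the branches
  -- off `U` too, and `φ⁻¹ '' U` competes in the definition of the hull of `T`.
  have hψ : BranchSupport G 𝒯 φ⁻¹ U := by
    rw [← isRigidSupport_fullVerts_iff hT hNoLeaf hU]
    exact ((isRigidSupport_fullVerts_iff hT hNoLeaf hA').2 hφ').mono
      (fullVerts_mono (hTU.trans (fullVerts_subset U)))
  have hsub : T ⊆ fullVerts 𝒯 (⇑φ⁻¹ '' U) := by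
    rw [fullVerts_image hT hAct hNoLeaf hU hψ]
    exact fun t ht => ⟨φ t, hTU ⟨t, ht, rfl⟩, φ.symm_apply_apply t⟩
  obtain ⟨x, hx, hxu⟩ := fullHull_subset (isAdmSet_image hT hAct hNoLeaf hγ hU hψ) hsub hu
  rw [Equiv.Perm.inv_eq_iff_eq] at hxu
  exact hxu ▸ hx

end BranchSupport

end BranchSupport

end RigidPerm

end

section

open Set

namespace RigidPerm

open SimpleGraph

/-! ### Admissible subgraphs versus admissible sets; elementary expansions via hulls. -/

section Bridge

variable {G V : Type*} [Group G] [MulAction G V] {𝒯 : SimpleGraph V}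
  {gates : Set (QuotientHalfEdge G 𝒯)}

/-- The half of the edge `{v, w}` at `v` is labelled by a gate. -/
def IsGate (gates : Set (QuotientHalfEdge G 𝒯)) (v w : V) : Prop :=
  ∃ h : 𝒯.Adj v w, halfEdgeLabel h ∈ gates

theorem IsGate.smul (hAct : ∀ (g : G) (v w : V), 𝒯.Adj v w → 𝒯.Adj (g • v) (g • w)) (g : G)
    (v w : V) (h : IsGate gates v w) : IsGate gates (g • v) (g • w) := by
  obtain ⟨hvw, hg⟩ := h
  refine ⟨hAct g v w hvw, ?_⟩
  have : (halfEdgeLabel (hAct g v w hvw) : QuotientHalfEdge G 𝒯) = halfEdgeLabel hvw :=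
    Quotient.sound (show MulAction.orbitRel G (V × V) (g • v, g • w) (v, w) from ⟨g, rfl⟩)
  rwa [this]

theorem IsAdmissible.connected {H : 𝒯.Subgraph} (hH : IsAdmissible gates H) : H.Connected :=
  hH.1.2

theorem IsAdmissible.interiorVerts_eq (hNoLeaf : ∀ v, ¬ ∃! w, 𝒯.Adj v w)
    (hT : 𝒯.IsTree) {H : 𝒯.Subgraph} (hH : IsAdmissible gates H) :
    interiorVerts H = fullVerts 𝒯 H.verts := by
  ext v
  constructor
  · intro hv
    refine ⟨hv.1, fun w hw => ?_⟩
    have : w ∈ H.neighborSet v := hH.2.2 v hv ▸ hw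
    exact H.edge_vert (Subgraph.Adj.symm this)
  · refine fun hv => ⟨hv.1, fun ⟨w, hw, huniq⟩ => hNoLeaf v ⟨w, hw.adj_sub, fun u hu => ?_⟩⟩
    exact huniq u (hT.subgraph_adj_of_mem hH.connected hv.1 (hv.2 u hu) hu)

theorem IsAdmissible.isAdmSet (hNoLeaf : ∀ v, ¬ ∃! w, 𝒯.Adj v w) (hT : 𝒯.IsTree)
    {H : 𝒯.Subgraph} (hH : IsAdmissible gates H) : IsAdmSet 𝒯 (IsGate gates) H.verts := by
  refine ⟨hH.1.1, hH.connected.nonempty, hT.geodConvex_verts hH.connected, fun v hv => ?_⟩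
  by_cases hl : IsLeaf H v
  · obtain ⟨w, hw, huniq⟩ := id hl
    exact Or.inr ⟨w, ⟨hv, H.edge_vert hw.symm, hw.adj_sub, fun u hu hvu =>
      huniq u (hT.subgraph_adj_of_mem hH.connected hv hu hvu)⟩, hw.adj_sub, hH.2.1 v w hl hw⟩
  · left
    rw [← hH.interiorVerts_eq hNoLeaf hT]
    exact ⟨hv, hl⟩

theorem IsAdmSet.isAdmissible (hNoLeaf : ∀ v, ¬ ∃! w, 𝒯.Adj v w) (hT : 𝒯.IsTree) {A : Set V}
    (hA : IsAdmSet 𝒯 (IsGate gates) A) :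
    IsAdmissible gates ((⊤ : 𝒯.Subgraph).induce A) := by
  refine ⟨⟨hA.finite, hA.convex.connected_induce hT.connected hA.nonempty⟩, ?_, ?_⟩
  · rintro v w ⟨x, hx, huniq⟩ h
    rcases hA.full_or_leaf v h.1 with hf | ⟨y, hy, hγ, hg⟩
    · exact absurd ⟨x, hx.2.2, fun u hu => huniq u ⟨h.1, hf.2 u hu, hu⟩⟩ (hNoLeaf v)
    · obtain rfl := hy.2.2.2 w h.2.1 h.2.2
      exact hg
  · rintro v ⟨hv, hl⟩
    ext w
    refine ⟨fun h => h.2.2, fun h => ?_⟩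
    rcases hA.full_or_leaf v hv with hf | ⟨y, hy, -⟩
    · exact ⟨hv, hf.2 w h, h⟩
    · exact absurd ⟨y, ⟨hv, hy.2.1, hy.2.2.1⟩, fun u hu => hy.2.2.2 u hu.2.1 hu.2.2⟩ hl

theorem exists_isAdmSet_subset_fullVerts (hNoLeaf : ∀ v, ¬ ∃! w, 𝒯.Adj v w) (hT : 𝒯.IsTree)
    (hLocFin : ∀ v, (𝒯.neighborSet v).Finite) (hGates : IsAdmissibleGateSystem gates)
    {X : Set V} (hX : X.Finite) :
    ∃ U, IsAdmSet 𝒯 (IsGate gates) U ∧ X ⊆ fullVerts 𝒯 U := by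
  classical
  obtain ⟨r⟩ := hT.connected.nonempty
  -- Including all neighbours makes the vertices of `X` interior; `r` covers the case of empty `X`.
  have hN : (insert r (X ∪ ⋃ v ∈ X, 𝒯.neighborSet v)).Finite :=
    (hX.union (hX.biUnion fun v _ => hLocFin v)).insert r
  obtain ⟨t, hst, ht⟩ := extend_finset_to_connected hT.connected.preconnected
    (t := hN.toFinset) ⟨r, by simp⟩
  have ht' : IsFiniteSubtree ((⊤ : 𝒯.Subgraph).induce (t : Set V)) :=
    ⟨t.finite_toSet, connected_induce_iff.1 ht⟩
  obtain ⟨H, hH, hle⟩ := hGates _ ht'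
  have hsub : insert r (X ∪ ⋃ v ∈ X, 𝒯.neighborSet v) ⊆ H.verts := fun x hx =>
    hle.1 (Finset.mem_coe.2 (hst (hN.mem_toFinset.2 hx)))
  refine ⟨H.verts, hH.isAdmSet hNoLeaf hT, fun x hx => ⟨hsub (Or.inr (Or.inl hx)), fun w hw => ?_⟩⟩
  exact hsub (Or.inr (Or.inr (mem_biUnion hx hw)))

theorem IsLeaf.notMem_interiorVerts {H : 𝒯.Subgraph} {v : V} (h : IsLeaf H v) :
    v ∉ interiorVerts H := fun hv => hv.2 h

theorem IsAdmissible.isLeaf {H : 𝒯.Subgraph} (hNoLeaf : ∀ v, ¬ ∃! w, 𝒯.Adj v w) (hT : 𝒯.IsTree)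
    (hH : IsAdmissible gates H) {v : V} (hv : v ∈ H.verts) (hf : v ∉ fullVerts 𝒯 H.verts) :
    IsLeaf H v := by
  by_contra hl
  rw [← hH.interiorVerts_eq hNoLeaf hT] at hf
  exact hf ⟨hv, hl⟩

/-- An elementary expansion of `T` is contained in the full hull of `T`. -/
theorem IsElementaryExpansion.le_and_subset_fullHull [Nontrivial V] (hNoLeaf : ∀ v, ¬ ∃! w, 𝒯.Adj v w)
    (hT : 𝒯.IsTree)
    (hex : ∀ X : Set V, X.Finite → ∃ U, IsAdmSet 𝒯 (IsGate gates) U ∧ X ⊆ fullVerts 𝒯 U)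
    {T T' : 𝒯.Subgraph} (hA : IsAdmissible gates T) (h : IsElementaryExpansion gates T T') :
    IsAdmissible gates T' ∧ T ≤ T' ∧ T'.verts ⊆ fullHull 𝒯 (IsGate gates) T.verts := by
  have hE := isAdmSet_fullHull hT hex hA.1.1 hA.connected.nonempty
  induction h with
  | refl => exact ⟨hA, le_rfl, subset_fullHull _⟩
  | @tail S S' _ hstep ih =>
    obtain ⟨hS, hTS, hSE⟩ := ih
    obtain ⟨v, hvT, hvS, ⟨hS', hlt, hvS'⟩, hmin⟩ := hstep
    refine ⟨hS', hTS.trans hlt.le, ?_⟩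
    have hvTv : v ∈ T.verts := let ⟨w, hw, _⟩ := hvT; T.edge_vert hw
    obtain ⟨w, hw, -⟩ := id hvT
    -- Since `v` is in `T`, it is interior to the hull, hence to this intersection; minimality of
    -- the leaf expansion `S'` then forces `S'` into the hull.
    have hU : IsAdmSet 𝒯 (IsGate gates) (S'.verts ∩ fullHull 𝒯 (IsGate gates) T.verts) :=
      (hS'.isAdmSet hNoLeaf hT).inter hT hE
        ⟨hlt.le.1 (hTS.1 hvTv), subset_fullHull _ hvTv⟩
        ⟨hlt.le.1 (hTS.1 (T.edge_vert hw.symm)), subset_fullHull _ (T.edge_vert hw.symm)⟩ hw.ne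
    have hU' := hU.isAdmissible hNoLeaf hT
    rw [hS'.interiorVerts_eq hNoLeaf hT] at hvS'
    have hvU : v ∈ interiorVerts ((⊤ : 𝒯.Subgraph).induce
        (S'.verts ∩ fullHull 𝒯 (IsGate gates) T.verts)) := by
      rw [hU'.interiorVerts_eq hNoLeaf hT]
      exact ⟨⟨hvS'.1, subset_fullHull _ hvTv⟩, fun u hu =>
        ⟨hvS'.2 u hu, (subset_fullVerts_fullHull T.verts hvTv).2 u hu⟩⟩
    have hSU : S ≤ (⊤ : 𝒯.Subgraph).induce (S'.verts ∩ fullHull 𝒯 (IsGate gates) T.verts) :=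
      (hT.subgraph_le_iff hU'.connected).2 (subset_inter hlt.le.1 hSE)
    have hle : (⊤ : 𝒯.Subgraph).induce (S'.verts ∩ fullHull 𝒯 (IsGate gates) T.verts) ≤ S' :=
      (hT.subgraph_le_iff hS'.connected).2 inter_subset_left
    have hmin' := hmin ⟨hU', lt_of_le_of_ne hSU fun h => hvS.notMem_interiorVerts (h ▸ hvU), hvU⟩
      hle
    exact hmin'.1.trans inter_subset_right

/-- If `S ⊊ T'` then some leaf of `S` is an interior vertex of `T'`. -/
theorem IsAdmSet.exists_leafDart_mem_fullVerts {γ : V → V → Prop} (hT : 𝒯.IsTree) {S T' : Set V}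
    (hS : IsAdmSet 𝒯 γ S) (hT' : IsAdmSet 𝒯 γ T') (h : S ⊂ T') :
    ∃ v w, LeafDart 𝒯 S v w ∧ v ∈ fullVerts 𝒯 T' := by
  obtain ⟨t, ht, htS⟩ := exists_of_ssubset h
  obtain ⟨v, w, hvw, htH⟩ := hS.exists_leafDart_of_notMem hT htS
  refine ⟨v, w, hvw, ?_⟩
  by_contra hf
  obtain ⟨x, hx, -⟩ := hT'.exists_leafDart_of_notMem_fullVerts (h.1 hvw.1) hf
  obtain rfl := hx.2.2.2 w (h.1 hvw.2.1) hvw.2.2.1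
  exact htS (hx.subset_cutBranch hT hT'.convex ht htH ▸ hvw.1)

/-- An admissible tree between `T` and its full hull is an elementary expansion of `T`. -/
theorem isElementaryExpansion_of_subset [Nontrivial V] (hNoLeaf : ∀ v, ¬ ∃! w, 𝒯.Adj v w)
    (hT : 𝒯.IsTree)
    (hex : ∀ X : Set V, X.Finite → ∃ U, IsAdmSet 𝒯 (IsGate gates) U ∧ X ⊆ fullVerts 𝒯 U)
    {T T' : 𝒯.Subgraph} (hA : IsAdmissible gates T) (hA' : IsAdmissible gates T') (hle : T ≤ T')
    (hsub : T'.verts ⊆ fullHull 𝒯 (IsGate gates) T.verts) :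
    IsElementaryExpansion gates T T' := by
  have hE := isAdmSet_fullHull hT hex hA.1.1 hA.connected.nonempty
  have hT' := hA'.isAdmSet hNoLeaf hT
  -- Induction on the number of vertices of `T'` still missing from `S`.
  have key : ∀ (n : ℕ) (S : 𝒯.Subgraph), IsAdmissible gates S → T ≤ S → S ≤ T' →
      IsElementaryExpansion gates T S → (T'.verts \ S.verts).ncard ≤ n →
      IsElementaryExpansion gates T T' := by
    intro n
    induction n with
    | zero =>
      intro S hS _ hST' hTS hn
      have : T'.verts \ S.verts = ∅ :=
        (ncard_eq_zero (hT'.finite.subset sdiff_subset)).1 (Nat.le_zero.1 hn)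
      have hle' : T' ≤ S := (hT.subgraph_le_iff hS.connected).2 (sdiff_eq_empty.1 this)
      rwa [le_antisymm hle' hST']
    | succ n ih =>
      intro S hS hTS hST' hexp hn
      rcases hST'.1.eq_or_ssubset with heq | hss
      · have hle' : T' ≤ S := (hT.subgraph_le_iff hS.connected).2 heq.symm.subset
        rwa [le_antisymm hle' hST']
      have hSA := hS.isAdmSet hNoLeaf hT
      obtain ⟨v, w, hvw, hvf⟩ := hSA.exists_leafDart_mem_fullVerts hT hT' hss
      have hvS := hvw.notMem_fullVerts hNoLeaf
      -- A leaf created during the expansion is also a leaf of the hull, so it cannot be interior to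
      -- `T'`; the next expansion therefore takes place at an original leaf.
      have hvT : v ∈ T.verts := by
        by_contra hvT
        exact notMem_fullVerts_fullHull hT hNoLeaf hE hSA hTS.1 (hss.1.trans hsub) hvw.1 hvT hvS
          (fullVerts_mono hsub hvf)
      -- The leaf expansion of `S` at `v`, as a least element; it stays inside `T'`.
      let U : Set V := ⋂₀ {U | IsAdmSet 𝒯 (IsGate gates) U ∧ S.verts ⊆ U ∧ v ∈ fullVerts 𝒯 U}
      have hUT' : U ⊆ T'.verts := sInter_subset_of_mem ⟨hT', hss.1, hvf⟩
      have hSU : S.verts ⊆ U := subset_sInter fun _ hU => hU.2.1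
      have hvU : v ∈ fullVerts 𝒯 U := ⟨hSU hvw.1, fun u hu _ hU => hU.2.2.2 u hu⟩
      have hU : IsAdmSet 𝒯 (IsGate gates) U := .sInter hT ⟨_, hT', hss.1, hvf⟩
        (fun _ hU => hU.1) (fun _ hU => hU.2.1 hvw.1) (fun _ hU => hU.2.1 hvw.2.1) hvw.2.2.1.ne
      have hUA := hU.isAdmissible hNoLeaf hT
      have hne : S.verts ≠ U := fun h => hvS (h ▸ hvU)
      have hSleU : S ≤ (⊤ : 𝒯.Subgraph).induce U := (hT.subgraph_le_iff hUA.connected).2 hSU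
      refine ih ((⊤ : 𝒯.Subgraph).induce U) hUA (hTS.trans hSleU)
        ((hT.subgraph_le_iff hA'.connected).2 hUT') ?_ ?_
      · refine Relation.ReflTransGen.tail hexp ⟨v, hA.isLeaf hNoLeaf hT hvT fun h =>
          hvS (fullVerts_mono hTS.1 h), hS.isLeaf hNoLeaf hT hvw.1 hvS, ?_⟩
        refine ⟨⟨hUA, lt_of_le_of_ne hSleU fun h => hne (congrArg Subgraph.verts h), ?_⟩,
          fun y hy _ => ?_⟩
        · rw [hUA.interiorVerts_eq hNoLeaf hT]
          exact hvU
        · refine (hT.subgraph_le_iff hy.1.connected).2 (sInter_subset_of_mem ?_)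
          refine ⟨hy.1.isAdmSet hNoLeaf hT, hy.2.1.le.1, ?_⟩
          rw [← hy.1.interiorVerts_eq hNoLeaf hT]
          exact hy.2.2
      · have : (T'.verts \ U).ncard < (T'.verts \ S.verts).ncard := by
          refine ncard_lt_ncard ⟨sdiff_subset_sdiff_right hSU, fun h => hne ?_⟩
            (hT'.finite.subset sdiff_subset)
          refine hSU.antisymm fun x hx => ?_
          by_contra hxS
          exact (h ⟨hUT' hx, hxS⟩).2 hx
        change (T'.verts \ U).ncard ≤ n
        omega
  exact key _ T hA le_rfl hle Relation.ReflTransGen.refl le_rfl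

end Bridge

end RigidPerm

end

section

open Set

namespace RigidPerm

open SimpleGraph

/-! ### The poset of classes and the hypotheses of the criterion. -/

section Classes

variable {G V : Type*} [Group G] [MulAction G V] {𝒯 : SimpleGraph V}

/-- A leafless tree with an action by automorphisms and a system of gates for which every finite
set of vertices lies in the interior of an admissible tree. -/
structure IsGateTree (gates : Set (QuotientHalfEdge G 𝒯)) : Prop where
  nontrivial : Nontrivial V
  isTree : 𝒯.IsTree
  noLeaf : ∀ v, ¬ ∃! w, 𝒯.Adj v w
  act : ∀ (g : G) (v w : V), 𝒯.Adj v w → 𝒯.Adj (g • v) (g • w)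
  exists_full : ∀ X : Set V, X.Finite → ∃ U, IsAdmSet 𝒯 (IsGate gates) U ∧ X ⊆ fullVerts 𝒯 U

variable {gates : Set (QuotientHalfEdge G 𝒯)} {T₀ : 𝒯.Subgraph} {B : Set V}

theorem TreePair.isAdmSet (hG : IsGateTree gates) (p : TreePair gates T₀ B) :
    IsAdmSet 𝒯 (IsGate gates) p.tree.verts := p.admissible.isAdmSet hG.noLeaf hG.isTree

theorem TreePair.equivalent_iff (hG : IsGateTree gates) {p q : TreePair gates T₀ B} :
    p.Equivalent q ↔ ⇑(q.perm⁻¹ * p.perm) '' p.tree.verts = q.tree.verts ∧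
      BranchSupport G 𝒯 (q.perm⁻¹ * p.perm) p.tree.verts := by
  rw [TreePair.Equivalent, p.admissible.interiorVerts_eq hG.noLeaf hG.isTree,
    isRigidSupport_fullVerts_iff hG.isTree hG.noLeaf (p.isAdmSet hG)]
  exact and_congr_left fun _ =>
    ⟨fun h => h.image_eq, fun h => h ▸ (Equiv.injective _).injOn.bijOn_image⟩

theorem TreePair.equivalence (hG : IsGateTree gates) :
    Equivalence (TreePair.Equivalent (gates := gates) (T₀ := T₀) (B := B)) := by
  have := hG.nontrivial
  refine ⟨fun p => ?_, fun {p q} h => ?_, fun {p q r} h h' => ?_⟩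
  · rw [TreePair.equivalent_iff hG, inv_mul_cancel]
    exact ⟨by simp, fun _ _ _ => ⟨1, fun u _ => (one_smul G u).symm⟩,
      fun _ => ⟨1, fun u => (one_smul G u).symm⟩⟩
  · rw [TreePair.equivalent_iff hG] at h ⊢
    have heq : p.perm⁻¹ * q.perm = (q.perm⁻¹ * p.perm)⁻¹ := by group
    rw [heq, ← h.1]
    refine ⟨?_, h.2.inv hG.isTree hG.act hG.noLeaf (p.isAdmSet hG)⟩
    exact (Equiv.symm_image_image (q.perm⁻¹ * p.perm) _)
  · rw [TreePair.equivalent_iff hG] at h h' ⊢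
    have heq : r.perm⁻¹ * p.perm = (r.perm⁻¹ * q.perm) * (q.perm⁻¹ * p.perm) := by group
    rw [heq, ← h'.1, ← h.1]
    refine ⟨?_, h.2.mul hG.isTree hG.act hG.noLeaf (p.isAdmSet hG) (h.1 ▸ h'.2)⟩
    rw [Equiv.Perm.coe_mul, image_comp]

theorem TreePair.toClass_eq_iff (hG : IsGateTree gates) {p q : TreePair gates T₀ B} :
    p.toClass = q.toClass ↔ p.Equivalent q :=
  Quot.eq.trans (TreePair.equivalence hG).eqvGen_iff

theorem TreeClass.exists_rep (x : TreeClass gates T₀ B) : ∃ p : TreePair gates T₀ B,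
    p.toClass = x := Quot.exists_rep x

/-- For a fixed permutation the tree is determined by the class, so comparisons of classes become
inclusions of trees. -/
theorem TreePair.tree_eq (hG : IsGateTree gates) {p q : TreePair gates T₀ B}
    (h : p.toClass = q.toClass) (hperm : p.perm = q.perm) : p.tree = q.tree := by
  rw [TreePair.toClass_eq_iff hG, TreePair.equivalent_iff hG, hperm, inv_mul_cancel] at h
  have h1 : p.tree.verts = q.tree.verts := by simpa using h.1
  exact le_antisymm ((hG.isTree.subgraph_le_iff q.admissible.connected).2 h1.le)
    ((hG.isTree.subgraph_le_iff p.admissible.connected).2 h1.ge)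

/-- Enlarge the tree of a pair. -/
def TreePair.withSet (hG : IsGateTree gates) (p : TreePair gates T₀ B) (A : Set V)
    (hA : IsAdmSet 𝒯 (IsGate gates) A) (hle : p.tree.verts ⊆ A) : TreePair gates T₀ B where
  tree := (⊤ : 𝒯.Subgraph).induce A
  admissible := hA.isAdmissible hG.noLeaf hG.isTree
  base_le := p.base_le.trans <| (hG.isTree.subgraph_le_iff
    (hA.isAdmissible hG.noLeaf hG.isTree).connected).2 hle
  perm := p.perm
  perm_mem := p.perm_mem

theorem TreePair.le_withSet (hG : IsGateTree gates) (p : TreePair gates T₀ B) {A : Set V}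
    (hA : IsAdmSet 𝒯 (IsGate gates) A) (hle : p.tree.verts ⊆ A) :
    p.tree ≤ (p.withSet hG A hA hle).tree :=
  (hG.isTree.subgraph_le_iff (hA.isAdmissible hG.noLeaf hG.isTree).connected).2 hle

/-- Enlargements of a pair can be transported to an equivalent pair. -/
theorem TreePair.Equivalent.exists_transport (hG : IsGateTree gates)
    {p q p' : TreePair gates T₀ B} (h : p.Equivalent q) (hperm : p'.perm = p.perm)
    (hle : p.tree ≤ p'.tree) : ∃ q' : TreePair gates T₀ B, q'.toClass = p'.toClass ∧
      q'.perm = q.perm ∧ q.tree ≤ q'.tree ∧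
      q'.tree.verts = ⇑(q.perm⁻¹ * p.perm) '' p'.tree.verts := by
  have := hG.nontrivial
  rw [TreePair.equivalent_iff hG] at h
  have hφ : BranchSupport G 𝒯 (q.perm⁻¹ * p.perm) p'.tree.verts := by
    rw [← isRigidSupport_fullVerts_iff hG.isTree hG.noLeaf (p'.isAdmSet hG)]
    exact ((isRigidSupport_fullVerts_iff hG.isTree hG.noLeaf (p.isAdmSet hG)).2 h.2).mono
      (fullVerts_mono hle.1)
  have hA := hφ.isAdmSet_image hG.isTree hG.act hG.noLeaf (IsGate.smul hG.act) (p'.isAdmSet hG)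
  have hsub : q.tree.verts ⊆ ⇑(q.perm⁻¹ * p.perm) '' p'.tree.verts :=
    h.1.symm.subset.trans (image_mono hle.1)
  refine ⟨q.withSet hG _ hA hsub, ?_, rfl, q.le_withSet hG hA hsub, rfl⟩
  rw [eq_comm, TreePair.toClass_eq_iff hG, TreePair.equivalent_iff hG, hperm]
  exact ⟨rfl, hφ⟩

/-- Any representative of the smaller class will do, so a whole chain can be written over one
permutation. -/
theorem TreeClass.Le.exists_rep (hG : IsGateTree gates) {x y : TreeClass gates T₀ B} (h : x.Le y)
    {p : TreePair gates T₀ B} (hp : p.toClass = x) : ∃ q : TreePair gates T₀ B,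
      q.toClass = y ∧ q.perm = p.perm ∧ p.tree ≤ q.tree := by
  obtain ⟨p₁, q₁, hp₁, rfl, hperm, hle⟩ := h
  have heq : p₁.Equivalent p := (TreePair.toClass_eq_iff hG).1 (hp₁.trans hp.symm)
  obtain ⟨q, hq, hqp, hqle, -⟩ := heq.exists_transport hG hperm.symm hle
  exact ⟨q, hq, hqp, hqle⟩

theorem TreePair.elemLe (hG : IsGateTree gates) {p q : TreePair gates T₀ B}
    (hperm : p.perm = q.perm) (hle : p.tree ≤ q.tree)
    (hsub : q.tree.verts ⊆ fullHull 𝒯 (IsGate gates) p.tree.verts) :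
    p.toClass.ElemLe q.toClass :=
  have := hG.nontrivial
  ⟨p, q, rfl, rfl, hperm, isElementaryExpansion_of_subset hG.noLeaf hG.isTree hG.exists_full
    p.admissible q.admissible hle hsub⟩

theorem TreeClass.ElemLe.exists_rep (hG : IsGateTree gates) {x y : TreeClass gates T₀ B}
    (h : x.ElemLe y) {p : TreePair gates T₀ B} (hp : p.toClass = x) :
    ∃ q : TreePair gates T₀ B, q.toClass = y ∧ q.perm = p.perm ∧ p.tree ≤ q.tree ∧
      q.tree.verts ⊆ fullHull 𝒯 (IsGate gates) p.tree.verts := by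
  have := hG.nontrivial
  obtain ⟨p₁, q₁, hp₁, rfl, hperm, hexp⟩ := h
  obtain ⟨-, hle, hsub⟩ :=
    hexp.le_and_subset_fullHull hG.noLeaf hG.isTree hG.exists_full p₁.admissible
  have heq : p₁.Equivalent p := (TreePair.toClass_eq_iff hG).1 (hp₁.trans hp.symm)
  obtain ⟨q, hq, hqp, hqle, hqv⟩ := heq.exists_transport hG hperm.symm hle
  refine ⟨q, hq, hqp, hqle, ?_⟩
  rw [TreePair.equivalent_iff hG] at heq
  rw [hqv, ← heq.1]
  exact (image_mono hsub).trans (heq.2.image_fullHull_subset hG.isTree hG.act hG.noLeaf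
    (IsGate.smul hG.act) (p₁.isAdmSet hG))

theorem TreeClass.Le.exists_rep_of_rep (hG : IsGateTree gates) {x y : TreeClass gates T₀ B}
    (h : x.Le y) {p q : TreePair gates T₀ B} (hp : p.toClass = x) (hq : q.toClass = y)
    (hperm : p.perm = q.perm) : p.tree ≤ q.tree := by
  obtain ⟨r, hr, hrp, hle⟩ := h.exists_rep hG hp
  rwa [TreePair.tree_eq hG (hr.trans hq.symm) (hrp.trans hperm)] at hle

/-- The order on classes of pairs. -/
abbrev TreeClass.partialOrder (hG : IsGateTree gates) : PartialOrder (TreeClass gates T₀ B) where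
  le := TreeClass.Le
  le_refl x := by
    obtain ⟨p, rfl⟩ := x.exists_rep
    exact ⟨p, p, rfl, rfl, rfl, le_rfl⟩
  le_trans x y z hxy hyz := by
    obtain ⟨p, hp⟩ := x.exists_rep
    obtain ⟨q, hq, hqp, hpq⟩ := hxy.exists_rep hG hp
    obtain ⟨r, hr, hrq, hqr⟩ := hyz.exists_rep hG hq
    exact ⟨p, r, hp, hr, (hrq.trans hqp).symm, hpq.trans hqr⟩
  le_antisymm x y hxy hyx := by
    obtain ⟨p, hp⟩ := x.exists_rep
    obtain ⟨q, hq, hqp, hpq⟩ := hxy.exists_rep hG hp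
    have hqp' := hyx.exists_rep_of_rep hG hq hp hqp
    have h1 := le_antisymm hpq hqp'
    rw [← hp, ← hq, TreePair.toClass_eq_iff hG]
    have h2 := (TreePair.equivalence hG).refl p
    rw [TreePair.equivalent_iff hG] at h2 ⊢
    rwa [← h1, hqp]

theorem TreeClass.ElemLe.le {x y : TreeClass gates T₀ B} (hG : IsGateTree gates)
    (h : x.ElemLe y) : x.Le y := by
  obtain ⟨p, hp⟩ := x.exists_rep
  obtain ⟨q, hq, hqp, hle, -⟩ := h.exists_rep hG hp
  exact ⟨p, q, hp, hq, hqp.symm, hle⟩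

/-- Over a common permutation, the tree of `w` lies in that of `b`, hence in the hull of `a`, hence
in the hull of `v`. -/
theorem TreeClass.ElemLe.of_le {a b v w : TreeClass gates T₀ B} (hG : IsGateTree gates)
    (h : a.ElemLe b) (hav : a.Le v) (hvw : v.Le w) (hwb : w.Le b) : v.ElemLe w := by
  obtain ⟨p, hp⟩ := a.exists_rep
  obtain ⟨q, hq, hqp, -, hsub⟩ := h.exists_rep hG hp
  obtain ⟨r, rfl, hrp, hpr⟩ := hav.exists_rep hG hp
  obtain ⟨s, rfl, hsr, hrs⟩ := hvw.exists_rep hG rfl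
  have hsq := hwb.exists_rep_of_rep hG rfl hq (hsr.trans (hrp.trans hqp.symm))
  exact TreePair.elemLe hG hsr.symm hrs (hsq.1.trans (hsub.trans (fullHull_mono hpr.1)))

/-- The greatest elementary expansion below a given upper bound. -/
theorem TreeClass.Le.exists_greatest {x y : TreeClass gates T₀ B} (hG : IsGateTree gates)
    (h : x.Le y) : ∃ c : TreeClass gates T₀ B, x.ElemLe c ∧ c.Le y ∧
      (∀ z : TreeClass gates T₀ B, x.ElemLe z → z.Le y → z.Le c) ∧ (x ≠ y → x ≠ c) := by
  have := hG.nontrivial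
  obtain ⟨p, rfl⟩ := x.exists_rep
  obtain ⟨q, rfl, hqp, hpq⟩ := h.exists_rep hG rfl
  have hpA := p.isAdmSet hG
  have hqA := q.isAdmSet hG
  have hE := isAdmSet_fullHull hG.isTree hG.exists_full hpA.finite hpA.nonempty
  have hsub : p.tree.verts ⊆ q.tree.verts ∩ fullHull 𝒯 (IsGate gates) p.tree.verts :=
    subset_inter hpq.1 (subset_fullHull _)
  obtain ⟨v, hv⟩ := hpA.nonempty
  obtain ⟨w, hw, hvw⟩ := hpA.exists_adj_mem hG.isTree hv
  have hA : IsAdmSet 𝒯 (IsGate gates) (q.tree.verts ∩ fullHull 𝒯 (IsGate gates) p.tree.verts) :=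
    hqA.inter hG.isTree hE (hsub hv) (hsub hw) hvw.ne
  have hAle := p.le_withSet hG hA hsub
  refine ⟨(p.withSet hG _ hA hsub).toClass, TreePair.elemLe hG rfl hAle inter_subset_right,
    ⟨_, q, rfl, rfl, hqp.symm, ?_⟩, fun z hz hzy => ?_, fun hne heq => hne ?_⟩
  · exact (hG.isTree.subgraph_le_iff q.admissible.connected).2 inter_subset_left
  · obtain ⟨r, rfl, hrp, hpr, hrE⟩ := hz.exists_rep hG rfl
    have hrq := hzy.exists_rep_of_rep hG rfl rfl (hrp.trans hqp.symm)
    refine ⟨r, _, rfl, rfl, hrp, ?_⟩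
    exact (hG.isTree.subgraph_le_iff (TreePair.admissible _).connected).2
      (subset_inter hrq.1 hrE)
  · have htree : p.tree.verts = q.tree.verts ∩ fullHull 𝒯 (IsGate gates) p.tree.verts :=
      congrArg Subgraph.verts (TreePair.tree_eq hG heq rfl)
    -- If the trees differed, some leaf of the smaller one would be interior to the larger one and
    -- to the hull, hence to their intersection, which is the smaller tree itself.
    have hpq' : p.tree.verts = q.tree.verts := by
      by_contra hne'
      obtain ⟨s, t, hst, hsf⟩ := hpA.exists_leafDart_mem_fullVerts hG.isTree hqA
        (hpq.1.ssubset_of_ne hne')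
      refine hst.notMem_fullVerts hG.noLeaf ⟨hst.1, fun u hu => ?_⟩
      rw [htree]
      exact ⟨hsf.2 u hu, (subset_fullVerts_fullHull _ hst.1).2 u hu⟩
    exact (TreeClass.partialOrder hG).le_antisymm _ _ h
      ⟨q, p, rfl, rfl, hqp, (hG.isTree.subgraph_le_iff p.admissible.connected).2 hpq'.ge⟩

/-- The witness is the intersection of `y` with the hull of `x'`; it contains `c` because the hull
of `x` lies in that of `x'`. -/
theorem TreeClass.ElemLe.exists_push {x x' y c : TreeClass gates T₀ B} (hG : IsGateTree gates)
    (hc : x.ElemLe c) (hxx' : x.Le x') (hx'y : x'.Le y) (hcy : c.Le y) :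
    ∃ z : TreeClass gates T₀ B, x'.ElemLe z ∧ c.Le z ∧ z.Le y := by
  have := hG.nontrivial
  obtain ⟨p, hp⟩ := x.exists_rep
  obtain ⟨p', rfl, hp'p, hpp'⟩ := hxx'.exists_rep hG hp
  obtain ⟨q, rfl, hqp', hp'q⟩ := hx'y.exists_rep hG rfl
  obtain ⟨r, rfl, hrp, -, hrE⟩ := hc.exists_rep hG hp
  have hrq := hcy.exists_rep_of_rep hG rfl rfl (hrp.trans (hqp'.trans hp'p).symm)
  have hpA := p'.isAdmSet hG
  have hE := isAdmSet_fullHull hG.isTree hG.exists_full hpA.finite hpA.nonempty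
  have hsub : p'.tree.verts ⊆ q.tree.verts ∩ fullHull 𝒯 (IsGate gates) p'.tree.verts :=
    subset_inter hp'q.1 (subset_fullHull _)
  obtain ⟨v, hv⟩ := hpA.nonempty
  obtain ⟨w, hw, hvw⟩ := hpA.exists_adj_mem hG.isTree hv
  have hA : IsAdmSet 𝒯 (IsGate gates) (q.tree.verts ∩ fullHull 𝒯 (IsGate gates) p'.tree.verts) :=
    (q.isAdmSet hG).inter hG.isTree hE (hsub hv) (hsub hw) hvw.ne
  refine ⟨(p'.withSet hG _ hA hsub).toClass,
    TreePair.elemLe hG rfl (p'.le_withSet hG hA hsub) inter_subset_right,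
    ⟨r, _, rfl, rfl, hrp.trans hp'p.symm, ?_⟩, ⟨_, q, rfl, rfl, hqp'.symm, ?_⟩⟩
  · exact (hG.isTree.subgraph_le_iff (TreePair.admissible _).connected).2
      (subset_inter hrq.1 (hrE.trans (fullHull_mono hpp'.1)))
  · exact (hG.isTree.subgraph_le_iff q.admissible.connected).2 inter_subset_left

/-- Rigid permutations are closed under inversion. -/
theorem IsRigidSupport.exists_inv (hG : IsGateTree gates) {φ : Equiv.Perm V} {F : Set V}
    (hF : F.Finite) (h : IsRigidSupport G 𝒯 φ F) :
    ∃ F' : Set V, F'.Finite ∧ IsRigidSupport G 𝒯 φ⁻¹ F' := by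
  have := hG.nontrivial
  obtain ⟨U, hU, hFU⟩ := hG.exists_full F hF
  have hφ := (isRigidSupport_fullVerts_iff hG.isTree hG.noLeaf hU).1 (h.mono hFU)
  have hA := hφ.isAdmSet_image hG.isTree hG.act hG.noLeaf (IsGate.smul hG.act) hU
  exact ⟨_, hA.finite.subset (fullVerts_subset _), (isRigidSupport_fullVerts_iff hG.isTree
    hG.noLeaf hA).2 (hφ.inv hG.isTree hG.act hG.noLeaf hU)⟩

theorem TreeClass.exists_le_le (hG : IsGateTree gates) (x y : TreeClass gates T₀ B) :
    ∃ z : TreeClass gates T₀ B, x.Le z ∧ y.Le z := by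
  have := hG.nontrivial
  obtain ⟨p, rfl⟩ := x.exists_rep
  obtain ⟨q, rfl⟩ := y.exists_rep
  obtain ⟨⟨F, hF, hpF⟩, -⟩ := p.perm_mem
  obtain ⟨⟨F₁, hF₁, hqF₁⟩, -⟩ := q.perm_mem
  obtain ⟨F', hF', hqF'⟩ := hqF₁.exists_inv hG hF₁
  -- `U` is so large that `p.perm` is supported in its interior, `q.perm⁻¹` in the interior of
  -- `p.perm '' U`, and the image of `U` under `q.perm⁻¹ * p.perm` contains the tree of `q`. The
  -- common bound is `[U, p.perm]`, rewritten over `q.perm`.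
  obtain ⟨U, hU, hsub⟩ := hG.exists_full
    (F ∪ p.tree.verts ∪ (⇑p.perm⁻¹ '' F' ∪ ⇑(p.perm⁻¹ * q.perm) '' q.tree.verts))
    ((hF.union (p.isAdmSet hG).finite).union
      ((hF'.image _).union ((q.isAdmSet hG).finite.image _)))
  rw [union_subset_iff, union_subset_iff, union_subset_iff] at hsub
  obtain ⟨⟨hFU, hpU⟩, hF'U, hqU⟩ := hsub
  have hp : BranchSupport G 𝒯 p.perm U :=
    (isRigidSupport_fullVerts_iff hG.isTree hG.noLeaf hU).1 (hpF.mono hFU)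
  have hpA := hp.isAdmSet_image hG.isTree hG.act hG.noLeaf (IsGate.smul hG.act) hU
  have hq : BranchSupport G 𝒯 q.perm⁻¹ (p.perm '' U) := by
    rw [← isRigidSupport_fullVerts_iff hG.isTree hG.noLeaf hpA]
    refine hqF'.mono fun u hu => ?_
    rw [hp.fullVerts_image hG.isTree hG.act hG.noLeaf hU]
    exact ⟨p.perm⁻¹ u, hF'U ⟨u, hu, rfl⟩, p.perm.apply_symm_apply u⟩
  have hφ := hp.mul hG.isTree hG.act hG.noLeaf hU hq
  have hA := hφ.isAdmSet_image hG.isTree hG.act hG.noLeaf (IsGate.smul hG.act) hU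
  have hpsub : p.tree.verts ⊆ U := hpU.trans (fullVerts_subset U)
  have hqsub : q.tree.verts ⊆ ⇑(q.perm⁻¹ * p.perm) '' U := by
    intro v hv
    refine ⟨_, fullVerts_subset U (hqU ⟨v, hv, rfl⟩), ?_⟩
    simp
  refine ⟨(p.withSet hG U hU hpsub).toClass, ⟨p, _, rfl, rfl, rfl, p.le_withSet hG hU hpsub⟩,
    ⟨q, q.withSet hG _ hA hqsub, rfl, ?_, rfl, q.le_withSet hG hA hqsub⟩⟩
  rw [eq_comm, TreePair.toClass_eq_iff hG, TreePair.equivalent_iff hG]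
  exact ⟨rfl, hφ⟩

/-- The number of vertices of the tree of a class. -/
noncomputable def TreeClass.rank (x : TreeClass gates T₀ B) : ℕ :=
  Quot.lift (fun p : TreePair gates T₀ B => p.tree.verts.ncard)
    (fun p q h => by
      rw [← h.1.image_eq]
      exact (ncard_image_of_injective _ (Equiv.injective _)).symm) x

theorem TreeClass.rank_strictMono (hG : IsGateTree gates) {x y : TreeClass gates T₀ B}
    (h : x.Le y) (hne : ¬ y.Le x) : x.rank < y.rank := by
  obtain ⟨p, rfl⟩ := x.exists_rep
  obtain ⟨q, rfl, hqp, hpq⟩ := h.exists_rep hG rfl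
  refine ncard_lt_ncard (hpq.1.ssubset_of_ne fun heq => hne ?_) (q.isAdmSet hG).finite
  exact ⟨q, p, rfl, rfl, hqp, (hG.isTree.subgraph_le_iff p.admissible.connected).2 heq.ge⟩

/-- Convexity spreads `≼` from the extreme pair of a chain to all pairs; conversely, pairwise
comparability makes the minimal and maximal elements extreme. -/
theorem mem_faces_steinComplex_iff (hG : IsGateTree gates) (s : Finset (TreeClass gates T₀ B)) :
    s ∈ (steinComplex gates T₀ B).faces ↔
      s.Nonempty ∧ ∀ a ∈ s, ∀ b ∈ s, a.ElemLe b ∨ b.ElemLe a := by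
  let := TreeClass.partialOrder (T₀ := T₀) (B := B) hG
  refine and_congr_right fun hne => ⟨?_, fun h => ?_⟩
  · rintro ⟨t, ⟨hchain, a, -, b, -, hab, hR⟩, hst⟩ v hv w hw
    have hrefl : Std.Refl (TreeClass.Le (gates := gates) (T₀ := T₀) (B := B)) :=
      ⟨fun x => le_refl x⟩
    exact (hchain.total (hst hv) (hst hw)).imp
      (fun h => hR.of_le hG (hab v (hst hv)).1 h (hab w (hst hw)).2)
      (fun h => hR.of_le hG (hab w (hst hw)).1 h (hab v (hst hv)).2)
  · have hcomp : ∀ v ∈ s, ∀ w ∈ s, v ≤ w ∨ w ≤ v := fun v hv w hw =>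
      (h v hv w hw).imp (fun h => h.le hG) fun h => h.le hG
    obtain ⟨a, ha⟩ := s.exists_minimal hne
    obtain ⟨b, hb⟩ := s.exists_maximal hne
    have ha' : ∀ v ∈ s, a ≤ v := fun v hv => (hcomp a ha.1 v hv).elim id fun h => ha.2 hv h
    have hb' : ∀ v ∈ s, v ≤ b := fun v hv => (hcomp v hv b hb.1).elim id fun h => hb.2 hv h
    refine ⟨s, ⟨fun v hv w hw _ => hcomp v hv w hw, a, ha.1, b, hb.1,
      fun v hv => ⟨ha' v hv, hb' v hv⟩, ?_⟩, subset_rfl⟩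
    rcases h a ha.1 b hb.1 with h | h
    · exact h
    · have : a = b := le_antisymm (ha' b hb.1) (h.le hG)
      rw [this] at h ⊢
      exact h

theorem IsGateTree.contractibleSpace_steinComplex (hG : IsGateTree gates)
    (hT₀ : IsAdmissible gates T₀) :
    ContractibleSpace (SimplicialRealization (steinComplex gates T₀ B)) := by
  let := TreeClass.partialOrder (T₀ := T₀) (B := B) hG
  have hdir : IsDirectedOrder (TreeClass gates T₀ B) := ⟨TreeClass.exists_le_le hG⟩
  have hne : Nonempty (TreeClass gates T₀ B) := ⟨TreePair.toClass
    ⟨T₀, hT₀, le_rfl, 1, ⟨∅, finite_empty, fun _ _ => ⟨1, fun v _ => (one_smul G v).symm⟩⟩,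
      fun _ _ => rfl⟩⟩
  exact contractibleSpace_of_greatest_successors (R := TreeClass.ElemLe)
    (mem_faces_steinComplex_iff hG) (fun _ _ h => h.le hG)
    (fun _ _ _ _ h h₁ h₂ h₃ => h.of_le hG h₁ h₂ h₃) (fun _ _ h => h.exists_greatest hG)
    (fun _ _ _ _ h₁ h₂ h₃ h₄ => h₃.exists_push hG h₁ h₂ h₄) TreeClass.rank
    fun _ _ h => TreeClass.rank_strictMono hG h.1 h.2

end Classes

end RigidPerm

end

theorem mainTheorem12 {G V : Type*} [Group G] [MulAction G V] (𝒯 : SimpleGraph V)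
    -- `𝒯` is an infinite locally finite tree without leaves
    (hTree : 𝒯.IsTree) (hInf : Infinite V)
    (hLocFin : ∀ v, (𝒯.neighborSet v).Finite)
    (hNoLeaf : ∀ v, ¬ ∃! w, 𝒯.Adj v w)
    -- `G` acts on `𝒯` by graph automorphisms, cocompactly and without inversions of edges
    (hAct : ∀ (g : G) (v w : V), 𝒯.Adj v w → 𝒯.Adj (g • v) (g • w))
    (hCocompact : Finite (MulAction.orbitRel.Quotient G V))
    (hNoInv : ∀ (g : G) (v w : V), 𝒯.Adj v w → ¬ (g • v = w ∧ g • w = v))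
    -- an admissible system of gates, and an admissible base tree with the finite set `B` inside
    (gates : Set (RigidPerm.QuotientHalfEdge G 𝒯))
    (hGates : RigidPerm.IsAdmissibleGateSystem gates)
    (T₀ : 𝒯.Subgraph) (hT₀ : RigidPerm.IsAdmissible gates T₀)
    (B : Set V) (hB : B.Finite) (hBT₀ : B ⊆ RigidPerm.interiorVerts T₀) :
    ContractibleSpace (SimplicialRealization (RigidPerm.steinComplex gates T₀ B)) :=
  RigidPerm.IsGateTree.contractibleSpace_steinComplex
    ⟨inferInstance, hTree, hNoLeaf, hAct, fun _ hX =>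
      RigidPerm.exists_isAdmSet_subset_fullVerts hNoLeaf hTree hLocFin hGates hX⟩ hT₀
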